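/- Let $d\ge 1$ and $\widehat\Omega=(0,1)^d$. A grid of $[0,1]$ is a sequence $0=z_0<z_1<\dots<z_N=1$ with $N\ge1$. For integers $p>k\ge0$, the spline space $S_{p,k}(Z)$ over such a grid $Z$ consists of all functions on $[0,1]$ that are $k$ times continuously differentiable on $(0,1)$ and coincide on each $[z_{i-1},z_i]$ with a polynomial of degree at most $p$. For a tuple $\mathbf Z=(Z_1,\dots,Z_d)$ of grids, let $h_{\mathbf Z}$ and $h_{\mathbf Z,\min}$ be the largest and the smallest length of a span $z_i-z_{i-1}$ in any of the grids $Z_1,\dots,Z_d$, and let $V_h:=S_{p,k,\mathbf Z}(\widehat\Omega)$ be the tensor-product spline space, i.e. the linear span of the functions $x\mapsto\prod_{j=1}^d f_j(x_j)$ with $f_j\in S_{p,k}(Z_j)$. Let $W^1_\infty(\widehat\Omega)$ be the space of all $\rho\in L^\infty(\widehat\Omega)$ with weak first derivatives in $L^\infty(\widehat\Omega)$, and $|\rho|_{W^1_\infty(\widehat\Omega)}:=\max_{1\le i\le d}\|\partial_i\rho\|_{L^\infty(\widehat\Omega)}$. For all integers $d\ge1$ and $p>k\ge 0$ and every real $\sigma$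 there is a constant $c>0$, depending only on $d$, $p$, $k$ and $\sigma$, such that for every tuple $\mathbf Z$ of $d$ grids of $[0,1]$ with $h_{\mathbf Z}/h_{\mathbf Z,\min}\le\sigma$, $$\inf_{v_h\in V_h}\|\rho w_h-v_h\|_{L^2(\widehat\Omega)}\le c\,h_{\mathbf Z}\,|\rho|_{W^1_\infty(\widehat\Omega)}\,\|w_h\|_{L^2(\widehat\Omega)}\qquad\text{for all } w_h\in V_h,\ \rho\in W^1_\infty(\widehat\Omega).$$ -/

import Mathlib

open MeasureTheory Set
open scoped ENNReal ContDiff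

/-- A grid `z 0 < z 1 < ... < z N` of breakpoints of the interval `[a, b]`, with `z 0 = a`,
`z N = b` and at least one span. -/
structure SplineGrid (a b : ℝ) where
  /-- the number of spans -/
  N : ℕ
  pos : 0 < N
  /-- the breakpoints -/
  z : Fin (N + 1) → ℝ
  strictMono : StrictMono z
  left : z 0 = a
  right : z (Fin.last N) = b

/-- The length of the largest span of a grid. -/
noncomputable def SplineGrid.meshSize {a b : ℝ} (Z : SplineGrid a b) : ℝ :=
  ⨆ i : Fin Z.N, (Z.z i.succ - Z.z i.castSucc)

/-- The length of the smallest span of a grid. -/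
noncomputable def SplineGrid.meshMin {a b : ℝ} (Z : SplineGrid a b) : ℝ :=
  ⨅ i : Fin Z.N, (Z.z i.succ - Z.z i.castSucc)

/-- The univariate splines of degree `p` and smoothness `k` over a grid of `[a, b]`: the
functions that are `k` times continuously differentiable on `(a, b)` and agree on every closed span
with a polynomial of degree at most `p`. The values outside `[a, b]` are irrelevant. -/
def univariateSplines (p k : ℕ) {a b : ℝ} (Z : SplineGrid a b) : Set (ℝ → ℝ) :=
  {f | ContDiffOn ℝ k f (Ioo a b) ∧
    ∀ i : Fin Z.N, ∃ q : Polynomial ℝ, q.natDegree ≤ p ∧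
      ∀ x ∈ Icc (Z.z i.castSucc) (Z.z i.succ), f x = q.eval x}

/-- The tensor-product spline space: the linear span of the products
`x ↦ f 0 (x 0) * ... * f (d - 1) (x (d - 1))`, where `f j` is a univariate spline over the grid
`Z j`. -/
def tensorSplineSpace {d : ℕ} (p k : ℕ) (Z : Fin d → SplineGrid 0 1) :
    Submodule ℝ ((Fin d → ℝ) → ℝ) :=
  Submodule.span ℝ
    {w | ∃ f : Fin d → ℝ → ℝ, (∀ j, f j ∈ univariateSplines p k (Z j)) ∧
      w = fun x => ∏ j, f j (x j)}

/-- The grid size of a tuple of grids: the largest span in any direction. -/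
noncomputable def gridSize {d : ℕ} (Z : Fin d → SplineGrid 0 1) : ℝ :=
  ⨆ j, (Z j).meshSize

/-- The smallest span of a tuple of grids in any direction. -/
noncomputable def gridSizeMin {d : ℕ} (Z : Fin d → SplineGrid 0 1) : ℝ :=
  ⨅ j, (Z j).meshMin

/-- The open unit cube `(0, 1) ^ d`. -/
def unitCube (d : ℕ) : Set (Fin d → ℝ) := Set.pi univ fun _ => Ioo (0 : ℝ) 1

/-- `g` is a weak partial derivative of `u` in the direction of the `i`-th coordinate on the open
set `Q`. -/
def IsWeakPartialDeriv {d : ℕ} (Q : Set (Fin d → ℝ)) (i : Fin d) (u g : (Fin d → ℝ) → ℝ) : Prop :=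
  LocallyIntegrableOn u Q ∧ LocallyIntegrableOn g Q ∧
    ∀ φ : (Fin d → ℝ) → ℝ, ContDiff ℝ ∞ φ → HasCompactSupport φ → tsupport φ ⊆ Q →
      ∫ x in Q, u x * fderiv ℝ φ x (Pi.single i 1) = - ∫ x in Q, g x * φ x

/-- Membership in the Sobolev space `W^1_∞(Q)`: the function is essentially bounded on `Q` and has
essentially bounded weak partial derivatives. -/
def MemW1Inf {d : ℕ} (Q : Set (Fin d → ℝ)) (u : (Fin d → ℝ) → ℝ) : Prop :=
  MemLp u ∞ (volume.restrict Q) ∧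
    ∀ i, ∃ g, IsWeakPartialDeriv Q i u g ∧ MemLp g ∞ (volume.restrict Q)

/-- The seminorm `max_i ‖∂_i u‖_{L^∞(Q)}` of `W^1_∞(Q)`. The weak derivative is unique up to a null
set, so the infimum is over representatives with the same norm. -/
noncomputable def seminormW1Inf {d : ℕ} (Q : Set (Fin d → ℝ)) (u : (Fin d → ℝ) → ℝ) : ℝ≥0∞ :=
  ⨆ i : Fin d, ⨅ (g : (Fin d → ℝ) → ℝ) (_ : IsWeakPartialDeriv Q i u g),
    eLpNorm g ∞ (volume.restrict Q)

/-- The norm of `L^2((0, 1) ^ d)`. -/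
noncomputable def normL2Cube {d : ℕ} (u : (Fin d → ℝ) → ℝ) : ℝ≥0∞ :=
  eLpNorm u 2 (volume.restrict (unitCube d))

/-! Suppose the identity on $V_h$ is a sum of integral operators $T_I$ with values in $V_h$ whose
kernels live within $O(h)$ of points $\xi_I$. Then $v=\sum_I\rho(y_I)\,T_Iw$, with $y_I$ near
$\xi_I$, is an admissible approximant, and $\rho w-v=\sum_I(\rho-\rho(y_I))\,T_Iw$. Since $\rho$ is
Lipschitz off a null set (`MemW1Inf.exists_lipschitz`, by mollification), each factor
$\rho-\rho(y_I)$ is $O(h|\rho|)$ wherever the kernel of $T_I$ is nonzero. If the absolute values of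
the kernels sum to at most $(C/h)^d$, the error is dominated by $O(h|\rho|)$ times the operator with
kernel $(C/h)^d$ on $|x-y|\le 2Ch$ (`exists_enorm_mul_sub_le`), and Schur's test bounds that
operator on $L^2$ uniformly in $h$.

Tensor products reduce the construction of $T_I$ to one variable (`exists_local_kernels`). There
$T_i=P_i-P_{i-1}$, where the cutoff $P_if$ equals $f$ left of $\tau_i$ and vanishes right of
$\tau_{i+p}$. It arises by continuing the polynomial piece of $f$ on span $i$ to the right and
subtracting a combination of truncated powers at $\tau_i,\dots,\tau_{i+p}$ that equals this
polynomial beyond $\tau_{i+p}$. Such a combination exists because the $p$-th powers shifted by $p+1$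
distinct knots span the polynomials of degree at most $p$. Truncated powers are $C^{p-1}$, so $k<p$
keeps $P_if$ in the spline space, and no B-spline basis is needed. The coefficients of a piece are
integrals of $f$ against dual polynomials, so $P_i$ has a kernel, which quasi-uniformity bounds by
$O(1/h)$. The sum telescopes to $P_N$, the identity. -/

/-! ### Dual polynomials for shifted powers -/

/-- The `L²(0, 1)` pairing of polynomials. -/
noncomputable def polynomialPairing : Polynomial ℝ →ₗ[ℝ] Polynomial ℝ →ₗ[ℝ] ℝ :=
  LinearMap.mk₂ ℝ (fun r q => ∫ t in (0 : ℝ)..1, r.eval t * q.eval t)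
    (fun r₁ r₂ q => by
      simp only [Polynomial.eval_add, add_mul]
      exact intervalIntegral.integral_add
        ((r₁.continuous.mul q.continuous).intervalIntegrable _ _)
        ((r₂.continuous.mul q.continuous).intervalIntegrable _ _))
    (fun c r q => by
      simp only [Polynomial.eval_smul, smul_eq_mul, mul_assoc]
      exact intervalIntegral.integral_const_mul _ _)
    (fun r q₁ q₂ => by
      simp only [Polynomial.eval_add, mul_add]
      exact intervalIntegral.integral_add
        ((r.continuous.mul q₁.continuous).intervalIntegrable _ _)
        ((r.continuous.mul q₂.continuous).intervalIntegrable _ _))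
    (fun c r q => by
      simp only [Polynomial.eval_smul, smul_eq_mul, mul_left_comm _ c]
      exact intervalIntegral.integral_const_mul _ _)

theorem polynomialPairing_apply (r q : Polynomial ℝ) :
    polynomialPairing r q = ∫ t in (0 : ℝ)..1, r.eval t * q.eval t := rfl

theorem eq_zero_of_polynomialPairing_self {q : Polynomial ℝ} (h : polynomialPairing q q = 0) :
    q = 0 := by
  rw [polynomialPairing_apply] at h
  by_contra hq
  have hex : ∃ c ∈ Icc (0 : ℝ) 1, 0 < q.eval c * q.eval c := by
    by_contra hcon
    push Not at hcon
    refine hq (Polynomial.eq_zero_of_infinite_isRoot q ?_)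
    refine (Icc_infinite (zero_lt_one (α := ℝ))).mono fun x hx => ?_
    exact mul_self_eq_zero.1 (le_antisymm (hcon x hx) (mul_self_nonneg _))
  exact (intervalIntegral.integral_pos zero_lt_one
    (q.continuous.mul q.continuous).continuousOn (fun x _ => mul_self_nonneg _) hex).ne' h

/-- The coefficient of $X^{p-i}$ in $\sum_b g_b(X-b)^p$ is $\binom{p}{i}\sum_b g_b(-b)^i$, so a
vanishing combination gives a Vandermonde system with distinct nodes $-b$. -/
theorem linearIndependent_shifted_pow (p : ℕ) :
    LinearIndependent ℝ (fun b : Fin (p + 1) =>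
      (Polynomial.X - Polynomial.C ((b : ℕ) : ℝ)) ^ p) := by
  rw [Fintype.linearIndependent_iff]
  intro g hg
  have hinj : Function.Injective (fun b : Fin (p + 1) => -((b : ℕ) : ℝ)) := by
    intro a b hab
    have : ((a : ℕ) : ℝ) = ((b : ℕ) : ℝ) := neg_injective hab
    exact Fin.ext (by exact_mod_cast this)
  have hz := Matrix.eq_zero_of_forall_pow_sum_mul_pow_eq_zero hinj (v := g) (fun i => by
    have hc := congrArg (fun q : Polynomial ℝ => q.coeff (p - i)) hg
    have hip : (i : ℕ) ≤ p := Nat.lt_succ_iff.1 i.2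
    simp only [Polynomial.finsetSum_coeff, Polynomial.coeff_smul, smul_eq_mul,
      Polynomial.coeff_zero, sub_eq_add_neg, ← Polynomial.C_neg,
      Polynomial.coeff_X_add_C_pow, Nat.sub_sub_self hip] at hc
    simp only [← mul_assoc, ← Finset.sum_mul] at hc
    have hne : ((p.choose (p - i) : ℕ) : ℝ) ≠ 0 := by
      exact_mod_cast (Nat.choose_pos (Nat.sub_le _ _)).ne'
    exact (mul_eq_zero.1 hc).resolve_right hne)
  exact fun b => congrFun hz b

/-- The shifted powers form a basis of the polynomials of degree at most $p$. The pairing is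
definite there, so each coordinate functional is represented by some `θ b`. Writing coefficients as
integrals is what later yields operators with kernels. -/
theorem exists_dual_polynomials (p : ℕ) :
    ∃ θ : Fin (p + 1) → Polynomial ℝ, ∀ q : Polynomial ℝ, q.natDegree ≤ p → ∀ u : ℝ,
      q.eval u = ∑ b, (∫ t in (0 : ℝ)..1, (θ b).eval t * q.eval t) * (u - (b : ℕ)) ^ p := by
  classical
  let V := Polynomial.degreeLT ℝ (p + 1)
  have hmem : ∀ q : Polynomial ℝ, q ∈ V ↔ q.natDegree ≤ p := by
    intro q
    rw [Polynomial.mem_degreeLT, Polynomial.degree_lt_iff_coeff_zero,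
      Polynomial.natDegree_le_iff_coeff_eq_zero]
    exact Iff.rfl
  have : FiniteDimensional ℝ V := Module.Finite.equiv (Polynomial.degreeLTEquiv ℝ (p + 1)).symm
  have hrank : Module.finrank ℝ V = p + 1 := by
    rw [(Polynomial.degreeLTEquiv ℝ (p + 1)).finrank_eq]; simp
  let v : Fin (p + 1) → V := fun b => ⟨(Polynomial.X - Polynomial.C ((b : ℕ) : ℝ)) ^ p,
    (hmem _).2 (by rw [Polynomial.natDegree_pow, Polynomial.natDegree_X_sub_C, mul_one])⟩
  have hv : LinearIndependent ℝ v :=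
    LinearIndependent.of_comp V.subtype (linearIndependent_shifted_pow p)
  let B := basisOfLinearIndependentOfCardEqFinrank hv (by simp [hrank])
  let Φ : V →ₗ[ℝ] Module.Dual ℝ V := polynomialPairing.compl₁₂ V.subtype V.subtype
  have hΦ : Function.Injective Φ := by
    rw [← LinearMap.ker_eq_bot, LinearMap.ker_eq_bot']
    intro q hq
    exact Subtype.ext (eq_zero_of_polynomialPairing_self (LinearMap.congr_fun hq q))
  have hsurj := (LinearMap.injective_iff_surjective_of_finrank_eq_finrank
    (Subspace.dual_finrank_eq (K := ℝ) (V := V)).symm).1 hΦ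
  choose θ hθ using fun b => hsurj (B.coord b)
  refine ⟨fun b => θ b, fun q hq u => ?_⟩
  have h1 := B.sum_repr ⟨q, (hmem q).2 hq⟩
  have h2 := congrArg (fun r : V => (r : Polynomial ℝ).eval u) h1
  simp only [AddSubmonoidClass.coe_finsetSum, Polynomial.eval_finsetSum] at h2
  rw [← h2]
  refine Finset.sum_congr rfl fun b _ => ?_
  have h3 := LinearMap.congr_fun (hθ b) ⟨q, (hmem q).2 hq⟩
  rw [Module.Basis.coord_apply] at h3
  rw [← h3]
  simp [B, v, Φ, polynomialPairing_apply]

/-! ### Truncated powers, knot sequences and splines -/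

theorem contDiff_max_pow (t : ℝ) (k p : ℕ) (hkp : k < p) :
    ContDiff ℝ k (fun x : ℝ => max (x - t) 0 ^ p) := by
  induction k generalizing p with
  | zero => exact contDiff_zero.2 (by fun_prop)
  | succ k ih =>
    obtain ⟨p, rfl⟩ : ∃ q, p = q + 1 := ⟨p - 1, by omega⟩
    have hder : ∀ x : ℝ, HasDerivAt (fun x : ℝ => max (x - t) 0 ^ (p + 1))
        ((p + 1) * max (x - t) 0 ^ p) x := by
      intro x
      have hp : p ≠ 0 := by omega
      have hpos : HasDerivAt (fun x : ℝ => (x - t) ^ (p + 1)) ((p + 1) * (x - t) ^ p) x := by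
        simpa using ((hasDerivAt_id x).sub_const t).fun_pow (p + 1)
      rcases lt_trichotomy x t with hx | hx | hx
      · rw [max_eq_right (by linarith), zero_pow hp, mul_zero]
        refine (hasDerivAt_const x (0 : ℝ)).congr_of_eventuallyEq ?_
        filter_upwards [Iio_mem_nhds hx] with y hy
        rw [max_eq_right (by linarith [mem_Iio.1 hy]), zero_pow (by omega)]
      -- At the knot itself both one-sided derivatives are zero, and they are glued.
      · subst hx
        rw [← hasDerivWithinAt_univ, ← Iic_union_Ici (a := x)]
        refine HasDerivWithinAt.union ?_ ?_
        · simp only [sub_self, max_self, zero_pow hp, mul_zero]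
          refine (hasDerivWithinAt_const x _ (0 : ℝ)).congr (fun y hy => ?_) (by simp)
          rw [max_eq_right (by linarith [mem_Iic.1 hy]), zero_pow (by omega)]
        · rw [max_eq_left (by linarith)]
          refine hpos.hasDerivWithinAt.congr (fun y hy => ?_) (by simp)
          rw [max_eq_left (by linarith [mem_Ici.1 hy])]
      · rw [max_eq_left (by linarith)]
        refine hpos.congr_of_eventuallyEq ?_
        filter_upwards [Ioi_mem_nhds hx] with y hy
        rw [max_eq_left (by linarith [mem_Ioi.1 hy])]
    push_cast
    rw [contDiff_succ_iff_deriv]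
    refine ⟨fun x => (hder x).differentiableAt, by simp, ?_⟩
    rw [show deriv (fun x : ℝ => max (x - t) 0 ^ (p + 1)) =
      fun x => ((p : ℝ) + 1) * max (x - t) 0 ^ p from funext fun x => (hder x).deriv]
    exact contDiff_const.mul (ih p (by omega))

/-- An increasing sequence of knots with `τ 0 = 0` and `τ N = 1` whose steps are
comparable to `h`. -/
structure IsKnotSequence (N : ℕ) (h σ : ℝ) (τ : ℕ → ℝ) : Prop where
  pos : 0 < N
  h_pos : 0 < h
  one_le : 1 ≤ σ
  zero : τ 0 = 0
  last : τ N = 1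
  step_le : ∀ i, τ (i + 1) - τ i ≤ h
  le_step : ∀ i, h ≤ σ * (τ (i + 1) - τ i)

namespace IsKnotSequence

variable {N : ℕ} {h σ : ℝ} {τ : ℕ → ℝ}

theorem step_pos (H : IsKnotSequence N h σ τ) (i : ℕ) : 0 < τ (i + 1) - τ i :=
  pos_of_mul_pos_right (H.h_pos.trans_le (H.le_step i)) (zero_le_one.trans H.one_le)

theorem strictMono (H : IsKnotSequence N h σ τ) : StrictMono τ :=
  strictMono_nat_of_lt_succ fun i => sub_pos.1 (H.step_pos i)

theorem add_le (H : IsKnotSequence N h σ τ) (i n : ℕ) : τ (i + n) ≤ τ i + n * h := by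
  induction n with
  | zero => simp
  | succ n ih =>
    have := H.step_le (i + n)
    push_cast
    rw [← add_assoc]
    linarith

theorem Icc_subset (H : IsKnotSequence N h σ τ) {i : ℕ} (hi : i < N) :
    Icc (τ i) (τ (i + 1)) ⊆ Icc 0 1 := by
  refine Icc_subset_Icc ?_ ?_
  · rw [← H.zero]; exact H.strictMono.monotone (Nat.zero_le _)
  · rw [← H.last]; exact H.strictMono.monotone hi

end IsKnotSequence

/-- The index of the span containing a point. -/
noncomputable def spanIndex (N : ℕ) (τ : ℕ → ℝ) (x : ℝ) : ℕ :=
  open Classical in Nat.findGreatest (fun l => τ l ≤ x) (N - 1)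

section spanIndex

variable {N : ℕ} {h σ : ℝ} {τ : ℕ → ℝ} {x : ℝ}

/-- The search stops at $N-1$, so the endpoint $x=1$ is assigned to the last span of the grid and
not to the span that begins there. -/
theorem spanIndex_lt (H : IsKnotSequence N h σ τ) : spanIndex N τ x < N := by
  have : spanIndex N τ x ≤ N - 1 := Nat.findGreatest_le _
  have := H.pos
  omega

theorem le_spanIndex {m : ℕ} (hm : m < N) (hx : τ m ≤ x) : m ≤ spanIndex N τ x :=
  Nat.le_findGreatest (by omega) hx

theorem knot_spanIndex_le (H : IsKnotSequence N h σ τ) (hx : 0 ≤ x) :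
    τ (spanIndex N τ x) ≤ x := by
  classical
  unfold spanIndex
  exact Nat.findGreatest_spec (P := fun l => τ l ≤ x) (Nat.zero_le _) (H.zero.trans_le hx)

theorem spanIndex_lt_of_lt (H : IsKnotSequence N h σ τ) (hx : 0 ≤ x) {m : ℕ} (hm : x < τ m) :
    spanIndex N τ x < m :=
  H.strictMono.lt_iff_lt.1 ((knot_spanIndex_le H hx).trans_lt hm)

theorem le_knot_spanIndex_succ (H : IsKnotSequence N h σ τ) (hx : x ≤ 1) :
    x ≤ τ (spanIndex N τ x + 1) := by
  by_contra hlt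
  push Not at hlt
  rcases lt_or_ge (spanIndex N τ x + 1) N with hN | hN
  · have := le_spanIndex hN hlt.le
    omega
  · have := H.strictMono.monotone hN
    rw [H.last] at this
    linarith

theorem mem_span_spanIndex (H : IsKnotSequence N h σ τ) (hx : x ∈ Icc (0 : ℝ) 1) :
    x ∈ Icc (τ (spanIndex N τ x)) (τ (spanIndex N τ x + 1)) :=
  ⟨knot_spanIndex_le H hx.1, le_knot_spanIndex_succ H hx.2⟩

end spanIndex

/-- The spline space over a knot sequence. -/
def splineSubmodule (p k N : ℕ) (τ : ℕ → ℝ) : Submodule ℝ (ℝ → ℝ) where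
  carrier := {f | ContDiffOn ℝ k f (Ioo 0 1) ∧ ∀ i < N, ∃ q : Polynomial ℝ, q.natDegree ≤ p ∧
    ∀ x ∈ Icc (τ i) (τ (i + 1)), f x = q.eval x}
  zero_mem' := ⟨contDiffOn_const, fun _ _ => ⟨0, by simp, fun _ _ => by simp⟩⟩
  add_mem' := by
    rintro f g ⟨hf, hf'⟩ ⟨hg, hg'⟩
    refine ⟨hf.add hg, fun i hi => ?_⟩
    obtain ⟨q, hq, hqf⟩ := hf' i hi
    obtain ⟨r, hr, hrg⟩ := hg' i hi
    exact ⟨q + r, (Polynomial.natDegree_add_le _ _).trans (max_le hq hr), fun x hx => by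
      rw [Pi.add_apply, hqf x hx, hrg x hx, Polynomial.eval_add]⟩
  smul_mem' := by
    rintro c f ⟨hf, hf'⟩
    refine ⟨contDiffOn_const.smul hf, fun i hi => ?_⟩
    obtain ⟨q, hq, hqf⟩ := hf' i hi
    exact ⟨c • q, (Polynomial.natDegree_smul_le _ _).trans hq, fun x hx => by
      rw [Pi.smul_apply, hqf x hx, Polynomial.eval_smul]⟩

theorem mem_splineSubmodule_congr {p k N : ℕ} {h σ : ℝ} {τ : ℕ → ℝ}
    (H : IsKnotSequence N h σ τ) {f g : ℝ → ℝ} (hf : f ∈ splineSubmodule p k N τ)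
    (hfg : ∀ x ∈ Icc (0 : ℝ) 1, g x = f x) : g ∈ splineSubmodule p k N τ := by
  refine ⟨hf.1.congr fun x hx => hfg x (Ioo_subset_Icc_self hx), fun i hi => ?_⟩
  obtain ⟨q, hq, hqf⟩ := hf.2 i hi
  exact ⟨q, hq, fun x hx => (hfg x (H.Icc_subset hi hx)).trans (hqf x hx)⟩

theorem max_pow_mem_splineSubmodule {p k N : ℕ} {h σ : ℝ} {τ : ℕ → ℝ}
    (H : IsKnotSequence N h σ τ) (hk : k < p) (m : ℕ) :
    (fun x => max (x - τ m) 0 ^ p) ∈ splineSubmodule p k N τ := by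
  refine ⟨(contDiff_max_pow _ k p hk).contDiffOn, fun i _ => ?_⟩
  rcases le_or_gt m i with hm | hm
  · refine ⟨(Polynomial.X - Polynomial.C (τ m)) ^ p, ?_, fun x hx => ?_⟩
    · rw [Polynomial.natDegree_pow, Polynomial.natDegree_X_sub_C, mul_one]
    · have := H.strictMono.monotone hm
      have hx1 := hx.1
      simp only [Polynomial.eval_pow, Polynomial.eval_sub, Polynomial.eval_X, Polynomial.eval_C]
      rw [max_eq_left (by linarith)]
  · refine ⟨0, by simp, fun x hx => ?_⟩
    have := H.strictMono.monotone (show i + 1 ≤ m from hm)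
    have hx2 := hx.2
    simp only [Polynomial.eval_zero]
    rw [max_eq_right (by linarith), zero_pow (by omega)]

/-! ### Coefficient functionals and cutoff operators -/

/-- The functional that recovers a coefficient of a polynomial on a span. -/
noncomputable def spanDual (τ : ℕ → ℝ) (r : Polynomial ℝ) (i : ℕ) (y : ℝ) : ℝ :=
  (Ioc (τ i) (τ (i + 1))).indicator
    (fun y => (τ (i + 1) - τ i)⁻¹ * r.eval ((y - τ i) / (τ (i + 1) - τ i))) y

theorem measurable_spanDual (τ : ℕ → ℝ) (r : Polynomial ℝ) (i : ℕ) :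
    Measurable (spanDual τ r i) := by
  unfold spanDual
  refine Measurable.indicator ?_ measurableSet_Ioc
  exact (measurable_const.mul (r.continuous.measurable.comp (by fun_prop)))

theorem spanDual_ne_zero {τ : ℕ → ℝ} {r : Polynomial ℝ} {i : ℕ} {y : ℝ}
    (hy : spanDual τ r i y ≠ 0) : y ∈ Icc (τ i) (τ (i + 1)) :=
  Ioc_subset_Icc_self (mem_of_indicator_ne_zero hy)

/-- The shifted power attached to a span. -/
noncomputable def spanPow (p : ℕ) (τ : ℕ → ℝ) (i b : ℕ) (x : ℝ) : ℝ :=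
  ((x - τ i) / (τ (i + 1) - τ i) - b) ^ p

section

variable {p k N : ℕ} {h σ : ℝ} {τ : ℕ → ℝ}

theorem integrableOn_spanDual_mul (H : IsKnotSequence N h σ τ) (r : Polynomial ℝ) {f : ℝ → ℝ}
    (hf : f ∈ splineSubmodule p k N τ) (i : ℕ) :
    IntegrableOn (fun y => spanDual τ r i y * f y) (Ioo 0 1) := by
  rcases lt_or_ge i N with hi | hi
  · obtain ⟨q, -, hq⟩ := hf.2 i hi
    have heq : (fun y => spanDual τ r i y * f y) = (Ioc (τ i) (τ (i + 1))).indicator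
        (fun y => (τ (i + 1) - τ i)⁻¹ * r.eval ((y - τ i) / (τ (i + 1) - τ i)) * q.eval y) := by
      funext y
      by_cases hy : y ∈ Ioc (τ i) (τ (i + 1))
      · simp only [spanDual, indicator_of_mem hy, hq y (Ioc_subset_Icc_self hy)]
      · simp only [spanDual, indicator_of_notMem hy, zero_mul]
    rw [heq]
    have hc : Continuous (fun y => (τ (i + 1) - τ i)⁻¹ *
        r.eval ((y - τ i) / (τ (i + 1) - τ i)) * q.eval y) :=
      (continuous_const.mul (r.continuous.comp (by fun_prop))).mul q.continuous
    refine Integrable.integrableOn ?_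
    rw [integrable_indicator_iff measurableSet_Ioc]
    exact (hc.integrableOn_Icc (a := τ i) (b := τ (i + 1))).mono_set Ioc_subset_Icc_self
  · refine (integrableOn_zero (s := Ioo (0 : ℝ) 1)).congr_fun (fun y hy => ?_) measurableSet_Ioo
    have : τ N ≤ τ i := H.strictMono.monotone hi
    rw [H.last] at this
    have hy' : y ∉ Ioc (τ i) (τ (i + 1)) := fun hy' => by linarith [hy.2, hy'.1]
    simp only [spanDual, indicator_of_notMem hy', zero_mul]

theorem integral_spanDual_mul (H : IsKnotSequence N h σ τ) (r q : Polynomial ℝ) {f : ℝ → ℝ}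
    {i : ℕ} (hi : i < N) (hq : ∀ x ∈ Icc (τ i) (τ (i + 1)), f x = q.eval x) :
    ∫ y in Ioo 0 1, spanDual τ r i y * f y =
      ∫ t in (0 : ℝ)..1, r.eval t * q.eval (τ i + (τ (i + 1) - τ i) * t) := by
  have hpos := H.step_pos i
  have hsub : Icc (τ i) (τ (i + 1)) ⊆ Icc 0 1 := H.Icc_subset hi
  have hle : τ i ≤ τ (i + 1) := by linarith
  have h0 : 0 ≤ τ i := (hsub (left_mem_Icc.2 hle)).1
  have h1 : τ (i + 1) ≤ 1 := (hsub (right_mem_Icc.2 hle)).2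
  have heq : (fun y => spanDual τ r i y * f y) = (Ioc (τ i) (τ (i + 1))).indicator
      (fun y => (τ (i + 1) - τ i)⁻¹ * (r.eval ((y - τ i) / (τ (i + 1) - τ i)) * q.eval y)) := by
    funext y
    by_cases hy : y ∈ Ioc (τ i) (τ (i + 1))
    · simp only [spanDual, indicator_of_mem hy, hq y (Ioc_subset_Icc_self hy), mul_assoc]
    · simp only [spanDual, indicator_of_notMem hy, zero_mul]
  rw [heq, ← integral_Ioc_eq_integral_Ioo, setIntegral_indicator measurableSet_Ioc,
    inter_eq_right.2 (Ioc_subset_Ioc h0 h1), ← intervalIntegral.integral_of_le hle,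
    intervalIntegral.integral_const_mul]
  have hcomp := intervalIntegral.integral_comp_mul_add
    (f := fun y => r.eval ((y - τ i) / (τ (i + 1) - τ i)) * q.eval y) (a := 0) (b := 1)
    hpos.ne' (τ i)
  rw [mul_zero, zero_add, mul_one, sub_add_cancel] at hcomp
  rw [smul_eq_mul] at hcomp
  rw [← hcomp]
  refine intervalIntegral.integral_congr fun t _ => ?_
  simp only [mul_div_cancel_left₀ _ hpos.ne', add_comm _ (τ i),
    add_sub_cancel_left]

/-- The coefficients of a spline on a span reproduce its polynomial piece. -/
theorem eval_eq_sum_spanDual (H : IsKnotSequence N h σ τ) {θ : Fin (p + 1) → Polynomial ℝ}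
    (hθ : ∀ q : Polynomial ℝ, q.natDegree ≤ p → ∀ u : ℝ,
      q.eval u = ∑ b, (∫ t in (0 : ℝ)..1, (θ b).eval t * q.eval t) * (u - (b : ℕ)) ^ p)
    {f : ℝ → ℝ} {q : Polynomial ℝ} (hqp : q.natDegree ≤ p)
    {i : ℕ} (hi : i < N) (hq : ∀ x ∈ Icc (τ i) (τ (i + 1)), f x = q.eval x) (x : ℝ) :
    ∑ b, (∫ y in Ioo 0 1, spanDual τ (θ b) i y * f y) * spanPow p τ i (b : ℕ) x = q.eval x := by
  have hpos := H.step_pos i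
  -- The dual polynomials live on $[0,1]$, so the piece is pulled back to it by the affine map of
  -- the span.
  have h1 := hθ (q.comp (Polynomial.C (τ i) + Polynomial.C (τ (i + 1) - τ i) * Polynomial.X)) (by
    refine Polynomial.natDegree_comp_le.trans ?_
    refine (Nat.mul_le_mul hqp (?_ : _ ≤ 1)).trans (mul_one p).le
    rw [add_comm]
    exact Polynomial.natDegree_linear_le) ((x - τ i) / (τ (i + 1) - τ i))
  simp only [Polynomial.eval_comp, Polynomial.eval_add, Polynomial.eval_C, Polynomial.eval_mul,
    Polynomial.eval_X, mul_div_cancel₀ _ hpos.ne', add_sub_cancel] at h1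
  rw [h1]
  refine Finset.sum_congr rfl fun b _ => ?_
  rw [integral_spanDual_mul H (θ b) q hi hq, spanPow]

end

/-- The combination of truncated powers at the knots `τ i, …, τ (i + p)` that agrees with
`spanPow p τ i b` to the right of these knots. -/
noncomputable def truncPow (p : ℕ) (τ : ℕ → ℝ) (i b : ℕ) (x : ℝ) : ℝ :=
  ∑ j ∈ Finset.range (p + 1),
    (Lagrange.basis (Finset.range (p + 1)) (fun j => τ (i + j)) j).eval
      (τ i + (τ (i + 1) - τ i) * b) * (max (x - τ (i + j)) 0 / (τ (i + 1) - τ i)) ^ p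

section

variable {p k N : ℕ} {h σ : ℝ} {τ : ℕ → ℝ}

/-- As a function of $s$, $(x-s)^p$ has degree at most $p$, so Lagrange interpolation at $p+1$
distinct knots reproduces it. -/
theorem sum_lagrange_basis_mul_sub_pow (H : IsKnotSequence N h σ τ) (i : ℕ) (x s : ℝ) :
    ∑ j ∈ Finset.range (p + 1),
      (Lagrange.basis (Finset.range (p + 1)) (fun j => τ (i + j)) j).eval s *
        (x - τ (i + j)) ^ p = (x - s) ^ p := by
  have hinj : Set.InjOn (fun j => τ (i + j)) (Finset.range (p + 1) : Set ℕ) := fun a _ b _ hab =>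
    Nat.add_left_cancel (H.strictMono.injective hab)
  have hdeg : ((Polynomial.C x - Polynomial.X) ^ p : Polynomial ℝ).degree <
      (Finset.range (p + 1)).card := by
    rw [Finset.card_range]
    refine (Polynomial.degree_le_natDegree).trans_lt ?_
    refine WithBot.coe_lt_coe.2 (Nat.lt_succ_of_le ?_)
    refine Polynomial.natDegree_pow_le.trans ?_
    refine (Nat.mul_le_mul_left p (?_ : _ ≤ 1)).trans (mul_one p).le
    exact (Polynomial.natDegree_sub_le _ _).trans (by simp)
  have h1 := congrArg (Polynomial.eval s) (Lagrange.eq_interpolate hinj hdeg)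
  rw [Lagrange.interpolate_apply, Polynomial.eval_finsetSum] at h1
  simp only [Polynomial.eval_pow, Polynomial.eval_sub, Polynomial.eval_C, Polynomial.eval_X,
    Polynomial.eval_mul] at h1
  rw [h1]
  exact Finset.sum_congr rfl fun j _ => mul_comm _ _

/-- Right of all the knots involved no truncation is active, and the interpolation identity applies
with $s=\tau_i+(\tau_{i+1}-\tau_i)b$. -/
theorem truncPow_eq_spanPow (H : IsKnotSequence N h σ τ) {i : ℕ} (b : ℕ) {x : ℝ}
    (hx : τ (i + p) ≤ x) : truncPow p τ i b x = spanPow p τ i b x := by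
  have hpos := H.step_pos i
  have h1 := sum_lagrange_basis_mul_sub_pow (p := p) H i x (τ i + (τ (i + 1) - τ i) * b)
  rw [spanPow, show (x - τ i) / (τ (i + 1) - τ i) - b =
    (x - (τ i + (τ (i + 1) - τ i) * b)) / (τ (i + 1) - τ i) by field_simp; ring,
    div_pow, ← h1, Finset.sum_div, truncPow]
  refine Finset.sum_congr rfl fun j hj => ?_
  have := H.strictMono.monotone (show i + j ≤ i + p by have := Finset.mem_range.1 hj; omega)
  rw [max_eq_left (by linarith), div_pow, mul_div_assoc]

theorem truncPow_eq_zero (H : IsKnotSequence N h σ τ) (hp : p ≠ 0) {i : ℕ} (b : ℕ) {x : ℝ}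
    (hx : x ≤ τ i) : truncPow p τ i b x = 0 := by
  refine Finset.sum_eq_zero fun j _ => ?_
  have := H.strictMono.monotone (Nat.le_add_right i j)
  rw [max_eq_right (by linarith), zero_div, zero_pow hp, mul_zero]

theorem truncPow_mem (H : IsKnotSequence N h σ τ) (hk : k < p) (i b : ℕ) :
    truncPow p τ i b ∈ splineSubmodule p k N τ := by
  have heq : truncPow p τ i b = ∑ j ∈ Finset.range (p + 1),
      ((Lagrange.basis (Finset.range (p + 1)) (fun j => τ (i + j)) j).eval
        (τ i + (τ (i + 1) - τ i) * b) * ((τ (i + 1) - τ i) ^ p)⁻¹) •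
          (fun x => max (x - τ (i + j)) 0 ^ p) := by
    funext x
    rw [Finset.sum_apply]
    refine Finset.sum_congr rfl fun j _ => ?_
    rw [Pi.smul_apply, smul_eq_mul, div_pow]
    ring
  rw [heq]
  exact Submodule.sum_mem _ fun j _ => Submodule.smul_mem _ _ (max_pow_mem_splineSubmodule H hk _)

/-- The integral kernel of the operator that keeps a spline to the left of `τ i` and replaces it by
zero to the right of `τ (i + p)`. -/
noncomputable def cutoffKernel (p N : ℕ) (θ : Fin (p + 1) → Polynomial ℝ) (τ : ℕ → ℝ) (i : ℕ)
    (x y : ℝ) : ℝ :=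
  ∑ b, spanDual τ (θ b) (min (spanIndex N τ x) i) y *
      spanPow p τ (min (spanIndex N τ x) i) (b : ℕ) x -
    ∑ b, spanDual τ (θ b) i y * truncPow p τ i (b : ℕ) x

theorem measurable_cutoffKernel (θ : Fin (p + 1) → Polynomial ℝ) (i : ℕ) (x : ℝ) :
    Measurable (cutoffKernel p N θ τ i x) := by
  unfold cutoffKernel
  refine Measurable.sub ?_ ?_ <;>
  exact Finset.measurable_sum _ fun b _ => (measurable_spanDual _ _ _).mul_const _

theorem cutoffKernel_mul_eq (θ : Fin (p + 1) → Polynomial ℝ) (i : ℕ) (x : ℝ) (f : ℝ → ℝ) :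
    (fun y => cutoffKernel p N θ τ i x y * f y) = fun y =>
      ∑ b, spanDual τ (θ b) (min (spanIndex N τ x) i) y * f y *
        spanPow p τ (min (spanIndex N τ x) i) (b : ℕ) x -
      ∑ b, spanDual τ (θ b) i y * f y * truncPow p τ i (b : ℕ) x := by
  funext y
  rw [cutoffKernel, sub_mul, Finset.sum_mul, Finset.sum_mul]
  simp only [mul_right_comm]

theorem integrableOn_cutoffKernel_mul (H : IsKnotSequence N h σ τ)
    (θ : Fin (p + 1) → Polynomial ℝ) {f : ℝ → ℝ} (hf : f ∈ splineSubmodule p k N τ) (i : ℕ)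
    (x : ℝ) : IntegrableOn (fun y => cutoffKernel p N θ τ i x y * f y) (Ioo 0 1) := by
  rw [cutoffKernel_mul_eq]
  exact (integrable_finsetSum _ fun b _ =>
    (integrableOn_spanDual_mul H (θ b) hf _).mul_const _).sub
    (integrable_finsetSum _ fun b _ => (integrableOn_spanDual_mul H (θ b) hf _).mul_const _)

theorem integral_cutoffKernel_mul (H : IsKnotSequence N h σ τ)
    (θ : Fin (p + 1) → Polynomial ℝ) {f : ℝ → ℝ} (hf : f ∈ splineSubmodule p k N τ) (i : ℕ)
    (x : ℝ) : ∫ y in Ioo 0 1, cutoffKernel p N θ τ i x y * f y =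
      ∑ b, (∫ y in Ioo 0 1, spanDual τ (θ b) (min (spanIndex N τ x) i) y * f y) *
        spanPow p τ (min (spanIndex N τ x) i) (b : ℕ) x -
      ∑ b, (∫ y in Ioo 0 1, spanDual τ (θ b) i y * f y) * truncPow p τ i (b : ℕ) x := by
  rw [cutoffKernel_mul_eq, integral_sub, integral_finsetSum, integral_finsetSum]
  · simp only [integral_mul_const]
  · exact fun b _ => (integrableOn_spanDual_mul H (θ b) hf _).mul_const _
  · exact fun b _ => (integrableOn_spanDual_mul H (θ b) hf _).mul_const _
  · exact integrable_finsetSum _ fun b _ => (integrableOn_spanDual_mul H (θ b) hf _).mul_const _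
  · exact integrable_finsetSum _ fun b _ => (integrableOn_spanDual_mul H (θ b) hf _).mul_const _

/-- Extending a spline beyond a span by its polynomial piece gives a spline. -/
theorem extend_mem_splineSubmodule (H : IsKnotSequence N h σ τ) {f F : ℝ → ℝ}
    (hf : f ∈ splineSubmodule p k N τ) {i : ℕ} {q : Polynomial ℝ} (hqp : q.natDegree ≤ p)
    (hl : ∀ x ∈ Icc (0 : ℝ) 1, x < τ (i + 1) → F x = f x)
    (hr : ∀ x ∈ Icc (0 : ℝ) 1, τ i ≤ x → F x = q.eval x) : F ∈ splineSubmodule p k N τ := by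
  have hlt := H.step_pos i
  refine ⟨?_, fun l hlN => ?_⟩
  · have hcov : Ioo (0 : ℝ) 1 = (Ioo 0 1 ∩ Iio (τ (i + 1))) ∪ (Ioo 0 1 ∩ Ioi (τ i)) := by
      rw [← inter_union_distrib_left, inter_eq_left.2]
      intro x _
      rcases lt_or_ge x (τ (i + 1)) with hx | hx
      · exact Or.inl hx
      · exact Or.inr (mem_Ioi.2 (by linarith))
    rw [hcov]
    refine ContDiffOn.union_of_isOpen ?_ ?_ (isOpen_Ioo.inter isOpen_Iio)
      (isOpen_Ioo.inter isOpen_Ioi)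
    · exact (hf.1.mono inter_subset_left).congr fun x hx =>
        hl x (Ioo_subset_Icc_self hx.1) hx.2
    · exact ((q.contDiff_aeval (𝕜 := ℝ) _).contDiffOn).congr fun x hx =>
        hr x (Ioo_subset_Icc_self hx.1) (le_of_lt hx.2)
  · rcases lt_or_ge l i with hli | hli
    · obtain ⟨r, hr', hrf⟩ := hf.2 l hlN
      refine ⟨r, hr', fun x hx => ?_⟩
      have := H.strictMono.monotone (show l + 1 ≤ i from hli)
      rw [hl x (H.Icc_subset hlN hx) (by linarith [hx.2]), hrf x hx]
    · refine ⟨q, hqp, fun x hx => hr x (H.Icc_subset hlN hx) ?_⟩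
      exact (H.strictMono.monotone hli).trans hx.1

/-- The first sum is $f$ up to the end of span $i$, continued by its polynomial piece there; the
overlap on span $i$ makes this smooth. The second sum has coefficients independent of $x$ and is a
combination of truncated powers. -/
theorem integral_cutoffKernel_mem (H : IsKnotSequence N h σ τ) (hk : k < p)
    {θ : Fin (p + 1) → Polynomial ℝ}
    (hθ : ∀ q : Polynomial ℝ, q.natDegree ≤ p → ∀ u : ℝ,
      q.eval u = ∑ b, (∫ t in (0 : ℝ)..1, (θ b).eval t * q.eval t) * (u - (b : ℕ)) ^ p)
    {f : ℝ → ℝ} (hf : f ∈ splineSubmodule p k N τ) (i : ℕ) :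
    (fun x => ∫ y in Ioo 0 1, cutoffKernel p N θ τ i x y * f y) ∈ splineSubmodule p k N τ := by
  simp only [integral_cutoffKernel_mul H θ hf]
  refine Submodule.sub_mem _ (x := fun x =>
      ∑ b, (∫ y in Ioo 0 1, spanDual τ (θ b) (min (spanIndex N τ x) i) y * f y) *
        spanPow p τ (min (spanIndex N τ x) i) (b : ℕ) x)
    (y := fun x => ∑ b, (∫ y in Ioo 0 1, spanDual τ (θ b) i y * f y) *
        truncPow p τ i (b : ℕ) x) ?_ ?_
  · have hrep : ∀ x ∈ Icc (0 : ℝ) 1, spanIndex N τ x ≤ i →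
        ∑ b, (∫ y in Ioo 0 1, spanDual τ (θ b) (min (spanIndex N τ x) i) y * f y) *
        spanPow p τ (min (spanIndex N τ x) i) (b : ℕ) x = f x := by
      intro x hx hi
      obtain ⟨q, hqp, hq⟩ := hf.2 _ (spanIndex_lt (x := x) H)
      rw [min_eq_left hi, eval_eq_sum_spanDual H hθ hqp (spanIndex_lt H) hq,
        hq x (mem_span_spanIndex H hx)]
    rcases lt_or_ge i N with hi | hi
    · obtain ⟨q, hqp, hq⟩ := hf.2 i hi
      refine extend_mem_splineSubmodule H hf hqp (i := i) (fun x hx hxi => ?_) (fun x hx hxi => ?_)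
      · exact hrep x hx (Nat.lt_succ_iff.1 (spanIndex_lt_of_lt H hx.1 hxi))
      · rw [min_eq_right (le_spanIndex hi hxi), eval_eq_sum_spanDual H hθ hqp hi hq]
    · exact mem_splineSubmodule_congr H hf fun x hx => hrep x hx ((spanIndex_lt H).le.trans hi)
  · have heq : (fun x => ∑ b, (∫ y in Ioo 0 1, spanDual τ (θ b) i y * f y) *
        truncPow p τ i (b : ℕ) x) = ∑ b, (∫ y in Ioo 0 1, spanDual τ (θ b) i y * f y) •
          truncPow p τ i ((b : Fin (p + 1)) : ℕ) := by
      funext x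
      rw [Finset.sum_apply]
      rfl
    rw [heq]
    exact Submodule.sum_mem _ fun b _ => Submodule.smul_mem _ _ (truncPow_mem H hk _ _)

/-- For $i=N$ nothing is cut off inside $[0,1]$: every point lies in a span of smaller index, and
truncated powers at knots from $\tau_N=1$ on vanish. -/
theorem integral_cutoffKernel_last (H : IsKnotSequence N h σ τ) (hk : k < p)
    {θ : Fin (p + 1) → Polynomial ℝ}
    (hθ : ∀ q : Polynomial ℝ, q.natDegree ≤ p → ∀ u : ℝ,
      q.eval u = ∑ b, (∫ t in (0 : ℝ)..1, (θ b).eval t * q.eval t) * (u - (b : ℕ)) ^ p)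
    {f : ℝ → ℝ} (hf : f ∈ splineSubmodule p k N τ) {x : ℝ} (hx : x ∈ Icc (0 : ℝ) 1) :
    ∫ y in Ioo 0 1, cutoffKernel p N θ τ N x y * f y = f x := by
  obtain ⟨q, hqp, hq⟩ := hf.2 _ (spanIndex_lt (x := x) H)
  rw [integral_cutoffKernel_mul H θ hf, min_eq_left (spanIndex_lt H).le,
    eval_eq_sum_spanDual H hθ hqp (spanIndex_lt H) hq, ← hq x (mem_span_spanIndex H hx),
    sub_eq_self]
  refine Finset.sum_eq_zero fun b _ => ?_
  rw [truncPow_eq_zero H (by omega) _ (by rw [H.last]; exact hx.2), mul_zero]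

theorem cutoffKernel_of_lt (H : IsKnotSequence N h σ τ) (hp : p ≠ 0)
    (θ : Fin (p + 1) → Polynomial ℝ) {i : ℕ} {x : ℝ} (hx : x ∈ Icc (0 : ℝ) 1)
    (hi : spanIndex N τ x < i) (y : ℝ) : cutoffKernel p N θ τ i x y =
      ∑ b, spanDual τ (θ b) (spanIndex N τ x) y * spanPow p τ (spanIndex N τ x) (b : ℕ) x := by
  rw [cutoffKernel, min_eq_left hi.le, sub_eq_self]
  refine Finset.sum_eq_zero fun b _ => ?_
  rw [truncPow_eq_zero H hp, mul_zero]
  exact (le_knot_spanIndex_succ H hx.2).trans (H.strictMono.monotone hi)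

theorem cutoffKernel_of_le (θ : Fin (p + 1) → Polynomial ℝ) {i : ℕ} {x : ℝ}
    (hi : i ≤ spanIndex N τ x) (y : ℝ) : cutoffKernel p N θ τ i x y =
      ∑ b, spanDual τ (θ b) i y * (spanPow p τ i (b : ℕ) x - truncPow p τ i (b : ℕ) x) := by
  rw [cutoffKernel, min_eq_right hi, ← Finset.sum_sub_distrib]
  simp only [mul_sub]

theorem cutoffKernel_of_add_le (H : IsKnotSequence N h σ τ)
    (θ : Fin (p + 1) → Polynomial ℝ) {i : ℕ} {x : ℝ} (hx : 0 ≤ x)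
    (hi : i + p ≤ spanIndex N τ x) (y : ℝ) : cutoffKernel p N θ τ i x y = 0 := by
  rw [cutoffKernel_of_le θ (by omega)]
  refine Finset.sum_eq_zero fun b _ => ?_
  rw [truncPow_eq_spanPow H b, sub_self, mul_zero]
  exact (H.strictMono.monotone hi).trans (knot_spanIndex_le H hx)

theorem cutoffKernel_ne_zero (H : IsKnotSequence N h σ τ) (hp : p ≠ 0)
    {θ : Fin (p + 1) → Polynomial ℝ} {i : ℕ} {x y : ℝ} (hx : x ∈ Icc (0 : ℝ) 1)
    (hne : cutoffKernel p N θ τ i x y ≠ 0) :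
    y ∈ Icc (τ (min (spanIndex N τ x) i)) (τ (min (spanIndex N τ x) i + 1)) := by
  rcases le_or_gt i (spanIndex N τ x) with hle | hlt
  · rw [min_eq_right hle]
    rw [cutoffKernel_of_le θ hle] at hne
    obtain ⟨b, -, hb⟩ := Finset.exists_ne_zero_of_sum_ne_zero hne
    exact spanDual_ne_zero (left_ne_zero_of_mul hb)
  · rw [min_eq_left hlt.le]
    rw [cutoffKernel_of_lt H hp θ hx hlt] at hne
    obtain ⟨b, -, hb⟩ := Finset.exists_ne_zero_of_sum_ne_zero hne
    exact spanDual_ne_zero (left_ne_zero_of_mul hb)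

end

/-! ### Size and support of the kernels -/

section

variable {p k N : ℕ} {h σ : ℝ} {τ : ℕ → ℝ}

theorem IsKnotSequence.le_mul_abs_sub (H : IsKnotSequence N h σ τ) {m n : ℕ} (hmn : m ≠ n) :
    h ≤ σ * |τ m - τ n| := by
  have hσ := zero_le_one.trans H.one_le
  have key : ∀ a b : ℕ, a < b → h ≤ σ * (τ b - τ a) := fun a b hab =>
    (H.le_step a).trans (mul_le_mul_of_nonneg_left
      (sub_le_sub_right (H.strictMono.monotone hab) _) hσ)
  rcases lt_or_gt_of_ne hmn with hlt | hlt
  · rw [abs_sub_comm]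
    exact (key m n hlt).trans (mul_le_mul_of_nonneg_left (le_abs_self _) hσ)
  · exact (key n m hlt).trans (mul_le_mul_of_nonneg_left (le_abs_self _) hσ)

theorem IsKnotSequence.div_step_mem (H : IsKnotSequence N h σ τ) {i : ℕ} {d : ℝ}
    (hd : d ∈ Icc 0 (p * h)) : d / (τ (i + 1) - τ i) ∈ Icc 0 (p * σ) := by
  have hpos := H.step_pos i
  refine ⟨div_nonneg hd.1 hpos.le, (div_le_iff₀ hpos).2 (hd.2.trans ?_)⟩
  rw [mul_assoc]
  exact mul_le_mul_of_nonneg_left (H.le_step i) (Nat.cast_nonneg _)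

/-- Both the scaled coordinate of $x$ and $b$ lie in $[0,p\sigma]$. -/
theorem abs_spanPow_le (H : IsKnotSequence N h σ τ) {i b : ℕ} (hb : b ≤ p) {x : ℝ}
    (hx : x ∈ Icc (τ i) (τ (i + p))) : |spanPow p τ i b x| ≤ (p * σ) ^ p := by
  have hu := H.div_step_mem (p := p) (i := i) (d := x - τ i)
    ⟨by linarith [hx.1], by linarith [hx.2, H.add_le i p]⟩
  have hb' : (b : ℝ) ≤ p := by exact_mod_cast hb
  have hb0 : (0 : ℝ) ≤ b := Nat.cast_nonneg b
  have hpσ : (p : ℝ) ≤ p * σ := le_mul_of_one_le_right (Nat.cast_nonneg _) H.one_le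
  rw [spanPow, abs_pow]
  refine pow_le_pow_left₀ (abs_nonneg _) (abs_le.2 ⟨?_, ?_⟩) _
  · linarith [hu.1]
  · linarith [hu.2]

/-- Each of the $p$ factors is a quotient. Its numerator is a difference of two points of
$[\tau_i,\tau_i+ph]$, and its denominator is at least $h/\sigma$ by quasi-uniformity. -/
theorem abs_eval_lagrange_basis_le (H : IsKnotSequence N h σ τ) {i b j : ℕ} (hb : b ≤ p)
    (hj : j ∈ Finset.range (p + 1)) :
    |(Lagrange.basis (Finset.range (p + 1)) (fun j => τ (i + j)) j).eval
      (τ i + (τ (i + 1) - τ i) * b)| ≤ (p * σ) ^ p := by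
  have hcard : ((Finset.range (p + 1)).erase j).card = p := by
    rw [Finset.card_erase_of_mem hj, Finset.card_range, Nat.add_sub_cancel]
  rw [Lagrange.basis, Polynomial.eval_prod, Finset.abs_prod]
  refine (Finset.prod_le_prod (fun _ _ => abs_nonneg _) (fun m hm => ?_)).trans_eq
    ((Finset.prod_const _).trans (by rw [hcard]))
  have hmj : i + j ≠ i + m := fun hjm => (Finset.mem_erase.1 hm).1 (by omega)
  have hmp : m ≤ p := by
    have := Finset.mem_range.1 (Finset.mem_erase.1 hm).2
    omega
  have hlow := H.le_mul_abs_sub hmj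
  have hne : 0 < |τ (i + j) - τ (i + m)| :=
    abs_pos.2 (sub_ne_zero.2 fun hEq => hmj (H.strictMono.injective hEq))
  rw [Lagrange.basisDivisor, Polynomial.eval_mul, Polynomial.eval_C, Polynomial.eval_sub,
    Polynomial.eval_X, Polynomial.eval_C, abs_mul, abs_inv, inv_mul_le_iff₀ hne]
  have hstep := H.step_le i
  have hb' : (b : ℝ) ≤ p := by exact_mod_cast hb
  have hmp' : (m : ℝ) ≤ p := by exact_mod_cast hmp
  have hbh : (τ (i + 1) - τ i) * b ≤ p * h := by
    rw [mul_comm]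
    exact mul_le_mul hb' hstep (H.step_pos i).le (Nat.cast_nonneg _)
  have hb0 : 0 ≤ (τ (i + 1) - τ i) * b := mul_nonneg (H.step_pos i).le (Nat.cast_nonneg _)
  have hm1 := H.add_le i m
  have hm2 := H.strictMono.monotone (Nat.le_add_right i m)
  have hm3 : (m : ℝ) * h ≤ p * h := mul_le_mul_of_nonneg_right hmp' H.h_pos.le
  have hph : (p : ℝ) * h ≤ p * (σ * |τ (i + j) - τ (i + m)|) :=
    mul_le_mul_of_nonneg_left hlow (Nat.cast_nonneg _)
  rw [mul_comm |_|, mul_assoc]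
  refine le_trans (abs_le.2 ⟨?_, ?_⟩) hph
  · linarith
  · linarith

theorem abs_truncPow_le (H : IsKnotSequence N h σ τ) {i b : ℕ} (hb : b ≤ p) {x : ℝ}
    (hx : x ≤ τ (i + p)) : |truncPow p τ i b x| ≤ (p + 1) * ((p * σ) ^ p * (p * σ) ^ p) := by
  refine (Finset.abs_sum_le_sum_abs _ _).trans ?_
  refine (Finset.sum_le_card_nsmul _ _ ((p * σ) ^ p * (p * σ) ^ p) fun j hj => ?_).trans_eq ?_
  · have hσ := zero_le_one.trans H.one_le
    rw [abs_mul]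
    refine mul_le_mul (abs_eval_lagrange_basis_le H hb hj) ?_ (abs_nonneg _) (by positivity)
    have hj' := H.strictMono.monotone (Nat.le_add_right i j)
    have hp := H.add_le i p
    have hph : 0 ≤ (p : ℝ) * h := mul_nonneg (Nat.cast_nonneg _) H.h_pos.le
    have hu := H.div_step_mem (p := p) (i := i) (d := max (x - τ (i + j)) 0)
      ⟨le_max_right _ _, max_le (by linarith) hph⟩
    rw [abs_pow, abs_of_nonneg hu.1]
    exact pow_le_pow_left₀ hu.1 hu.2 _
  · simp

theorem abs_spanDual_le (H : IsKnotSequence N h σ τ) {r : Polynomial ℝ} {Θ : ℝ}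
    (hΘ : ∀ t ∈ Icc (0 : ℝ) 1, |r.eval t| ≤ Θ) (i : ℕ) (y : ℝ) :
    |spanDual τ r i y| ≤ σ / h * Θ := by
  have hpos := H.step_pos i
  have hσ := zero_lt_one.trans_le H.one_le
  have hh := H.h_pos
  have hΘ0 : 0 ≤ Θ := (abs_nonneg _).trans (hΘ 0 ⟨le_rfl, zero_le_one⟩)
  by_cases hy : y ∈ Ioc (τ i) (τ (i + 1))
  · rw [spanDual, indicator_of_mem hy, abs_mul]
    refine mul_le_mul ?_ (hΘ _ ⟨?_, ?_⟩) (abs_nonneg _) (by positivity)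
    · rw [abs_inv, abs_of_pos hpos, inv_le_comm₀ hpos (by positivity), inv_div,
        div_le_iff₀' hσ]
      exact H.le_step i
    · exact div_nonneg (by linarith [hy.1]) hpos.le
    · rw [div_le_one hpos]; linarith [hy.2]
  · rw [spanDual, indicator_of_notMem hy, abs_zero]
    positivity

/-- The factor $1/h$ comes from `spanDual`. The shifted powers grow away from span $i$, but they
matter only up to $\tau_{i+p}$: beyond it the two sums cancel and the kernel is zero. -/
theorem abs_cutoffKernel_le (H : IsKnotSequence N h σ τ) (hp : p ≠ 0)
    {θ : Fin (p + 1) → Polynomial ℝ} {Θ : ℝ}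
    (hΘ : ∀ b, ∀ t ∈ Icc (0 : ℝ) 1, |(θ b).eval t| ≤ Θ) (i : ℕ) {x : ℝ}
    (hx : x ∈ Icc (0 : ℝ) 1) (y : ℝ) : |cutoffKernel p N θ τ i x y| ≤
      (p + 1) * (σ / h * Θ * ((p * σ) ^ p + (p + 1) * ((p * σ) ^ p * (p * σ) ^ p))) := by
  have hσ := zero_lt_one.trans_le H.one_le
  have hh := H.h_pos
  have hΘ0 : 0 ≤ Θ := (abs_nonneg _).trans (hΘ 0 0 ⟨le_rfl, zero_le_one⟩)
  have hsum : ∀ g : Fin (p + 1) → ℝ, (∀ b, |g b| ≤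
      σ / h * Θ * ((p * σ) ^ p + (p + 1) * ((p * σ) ^ p * (p * σ) ^ p))) →
      |∑ b, g b| ≤ (p + 1) *
        (σ / h * Θ * ((p * σ) ^ p + (p + 1) * ((p * σ) ^ p * (p * σ) ^ p))) := by
    intro g hg
    refine (Finset.abs_sum_le_sum_abs _ _).trans
      ((Finset.sum_le_card_nsmul _ _ _ fun b _ => hg b).trans_eq ?_)
    simp
  rcases lt_or_ge (spanIndex N τ x) i with hi | hi
  · rw [cutoffKernel_of_lt H hp θ hx hi]
    refine hsum _ fun b => ?_
    rw [abs_mul]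
    refine mul_le_mul (abs_spanDual_le H (hΘ b) _ _) ?_ (abs_nonneg _) (by positivity)
    have hm := mem_span_spanIndex H hx
    refine (abs_spanPow_le H (Nat.lt_succ_iff.1 b.2) ⟨hm.1, hm.2.trans ?_⟩).trans
      (le_add_of_nonneg_right (by positivity))
    exact H.strictMono.monotone (by omega)
  · rcases lt_or_ge (spanIndex N τ x) (i + p) with hip | hip
    · rw [cutoffKernel_of_le θ hi]
      refine hsum _ fun b => ?_
      rw [abs_mul]
      refine mul_le_mul (abs_spanDual_le H (hΘ b) _ _) ?_ (abs_nonneg _) (by positivity)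
      have hm := mem_span_spanIndex H hx
      have h1 : τ i ≤ x := (H.strictMono.monotone hi).trans hm.1
      have h2 : x ≤ τ (i + p) := hm.2.trans (H.strictMono.monotone hip)
      exact (abs_sub _ _).trans (add_le_add (abs_spanPow_le H (Nat.lt_succ_iff.1 b.2) ⟨h1, h2⟩)
        (abs_truncPow_le H (Nat.lt_succ_iff.1 b.2) h2))
    · rw [cutoffKernel_of_add_le H θ hx.1 hip, abs_zero]
      positivity

/-- The differences of successive cutoff kernels. -/
noncomputable def localKernel (p N : ℕ) (θ : Fin (p + 1) → Polynomial ℝ) (τ : ℕ → ℝ) (i : ℕ)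
    (x y : ℝ) : ℝ :=
  cutoffKernel p N θ τ i x y - if i = 0 then 0 else cutoffKernel p N θ τ (i - 1) x y

/-- Two successive cutoffs agree where neither has begun to act, and both vanish where both are
complete. -/
theorem spanIndex_of_localKernel_ne_zero (H : IsKnotSequence N h σ τ) (hp : p ≠ 0)
    {θ : Fin (p + 1) → Polynomial ℝ} {i : ℕ} {x y : ℝ} (hx : x ∈ Icc (0 : ℝ) 1)
    (hne : localKernel p N θ τ i x y ≠ 0) :
    i ≤ spanIndex N τ x + 1 ∧ spanIndex N τ x < i + p := by
  constructor
  · by_contra hlt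
    push Not at hlt
    refine hne ?_
    rw [localKernel, if_neg (by omega), cutoffKernel_of_lt H hp θ hx (by omega),
      cutoffKernel_of_lt H hp θ hx (by omega), sub_self]
  · by_contra hle
    push Not at hle
    refine hne ?_
    rw [localKernel, cutoffKernel_of_add_le H θ hx.1 hle]
    split_ifs
    · simp
    · rw [cutoffKernel_of_add_le H θ hx.1 (by omega), sub_self]

/-- Both points lie in spans with indices from $i-1$ to $i+p$, hence within $p+2$ steps of
$\tau_{i-1}$. For $i=0$ truncated subtraction makes the centre $\tau_0$. -/
theorem abs_sub_knot_le_of_localKernel_ne_zero (H : IsKnotSequence N h σ τ) (hp : p ≠ 0)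
    {θ : Fin (p + 1) → Polynomial ℝ} {i : ℕ} {x y : ℝ} (hx : x ∈ Icc (0 : ℝ) 1)
    (hne : localKernel p N θ τ i x y ≠ 0) :
    |x - τ (i - 1)| ≤ (p + 2) * h ∧ |y - τ (i - 1)| ≤ (p + 2) * h := by
  obtain ⟨h1, h2⟩ := spanIndex_of_localKernel_ne_zero H hp hx hne
  have hh := H.h_pos
  have key : ∀ m z, i - 1 ≤ m → m ≤ i + p → z ∈ Icc (τ m) (τ (m + 1)) →
      |z - τ (i - 1)| ≤ (p + 2) * h := by
    intro m z hm hm' hz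
    have e1 := H.strictMono.monotone hm
    have e2 := H.strictMono.monotone (show m + 1 ≤ (i - 1) + (p + 2) by omega)
    have e3 := H.add_le (i - 1) (p + 2)
    push_cast at e3
    rw [abs_of_nonneg (by linarith [hz.1])]
    linarith [hz.2]
  refine ⟨key _ x (by omega) (by omega) (mem_span_spanIndex H hx), ?_⟩
  by_cases hi : cutoffKernel p N θ τ i x y = 0
  · rw [localKernel, hi, zero_sub, neg_ne_zero] at hne
    split_ifs at hne with hi0
    · exact absurd rfl hne
    · exact key _ y (by omega) (by omega) (cutoffKernel_ne_zero H hp hx hne)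
  · exact key _ y (by omega) (by omega) (cutoffKernel_ne_zero H hp hx hi)

theorem sum_localKernel_eq (θ : Fin (p + 1) → Polynomial ℝ) (n : ℕ) (x y : ℝ) :
    ∑ i ∈ Finset.range (n + 1), localKernel p N θ τ i x y = cutoffKernel p N θ τ n x y := by
  induction n with
  | zero => simp [localKernel]
  | succ n ih =>
    rw [Finset.sum_range_succ, ih, localKernel, if_neg (by omega), Nat.add_sub_cancel]
    ring

theorem sum_abs_localKernel_le (H : IsKnotSequence N h σ τ) (hp : p ≠ 0)
    {θ : Fin (p + 1) → Polynomial ℝ} {A : ℝ} {x y : ℝ} (hx : x ∈ Icc (0 : ℝ) 1)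
    (hA : ∀ i, |cutoffKernel p N θ τ i x y| ≤ A) (n : ℕ) :
    ∑ i ∈ Finset.range n, |localKernel p N θ τ i x y| ≤ (p + 1) * (2 * A) := by
  have hA0 : 0 ≤ A := (abs_nonneg _).trans (hA 0)
  have hle : ∀ i, |localKernel p N θ τ i x y| ≤ 2 * A := by
    intro i
    refine (abs_sub _ _).trans ?_
    have h2 : |if i = 0 then 0 else cutoffKernel p N θ τ (i - 1) x y| ≤ A := by
      split_ifs
      · rwa [abs_zero]
      · exact hA _
    linarith [hA i]
  set l := spanIndex N τ x
  calc ∑ i ∈ Finset.range n, |localKernel p N θ τ i x y|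
      -- At a fixed $x$ at most $p+1$ kernels are nonzero, however many spans there are.
      ≤ ∑ i ∈ Finset.Icc (l + 1 - p) (l + 1), |localKernel p N θ τ i x y| := by
        rw [← Finset.sum_filter_ne_zero]
        refine Finset.sum_le_sum_of_subset_of_nonneg (fun i hi => ?_) fun _ _ _ => abs_nonneg _
        replace hi := (Finset.mem_filter.1 hi).2
        have := spanIndex_of_localKernel_ne_zero H hp hx (abs_ne_zero.1 hi)
        exact Finset.mem_Icc.2 ⟨by omega, by omega⟩
    _ ≤ (Finset.Icc (l + 1 - p) (l + 1)).card • (2 * A) :=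
        Finset.sum_le_card_nsmul _ _ _ fun i _ => hle i
    _ ≤ (p + 1) * (2 * A) := by
        rw [nsmul_eq_mul]
        refine mul_le_mul_of_nonneg_right ?_ (by linarith)
        have : (Finset.Icc (l + 1 - p) (l + 1)).card ≤ p + 1 := by
          rw [Nat.card_Icc]; omega
        exact_mod_cast this

end

/-! ### Local kernels over a grid -/

/-- The knots of a grid of the unit interval, continued to the right by steps of length `h`. -/
noncomputable def SplineGrid.knots (Z : SplineGrid 0 1) (h : ℝ) (n : ℕ) : ℝ :=
  if hn : n < Z.N + 1 then Z.z ⟨n, hn⟩ else 1 + (n - Z.N) * h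

theorem SplineGrid.knots_succ_eq (Z : SplineGrid 0 1) (h : ℝ) (i : Fin Z.N) :
    Z.knots h (i + 1) = Z.z i.succ ∧ Z.knots h i = Z.z i.castSucc := by
  constructor
  · rw [knots, dif_pos (by omega)]; rfl
  · rw [knots, dif_pos (by omega)]; rfl

/-- The knots beyond $1$ supply the $p+1$ nodes that `truncPow` needs near the right end. Steps of
length $h$ satisfy the lower bound because $\sigma\ge1$. -/
theorem SplineGrid.isKnotSequence (Z : SplineGrid 0 1) {h σ : ℝ} (hh : 0 < h) (hσ : 1 ≤ σ)
    (hle : ∀ i : Fin Z.N, Z.z i.succ - Z.z i.castSucc ≤ h)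
    (hge : ∀ i : Fin Z.N, h ≤ σ * (Z.z i.succ - Z.z i.castSucc)) :
    IsKnotSequence Z.N h σ (Z.knots h) := by
  have hlast : Z.knots h Z.N = 1 := by
    rw [knots, dif_pos (Nat.lt_succ_self _)]
    exact Z.right
  have hstep : ∀ i, Z.N ≤ i → Z.knots h (i + 1) - Z.knots h i = h := by
    intro i hi
    have h2 : Z.knots h i = 1 + ((i : ℝ) - Z.N) * h := by
      rcases hi.eq_or_lt with rfl | hi
      · rw [hlast]; simp
      · rw [knots, dif_neg (by omega)]
    rw [h2, knots, dif_neg (by omega)]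
    push_cast
    ring
  refine ⟨Z.pos, hh, hσ, ?_, hlast, fun i => ?_, fun i => ?_⟩
  · rw [knots, dif_pos (Nat.succ_pos _)]
    exact Z.left
  · rcases lt_or_ge i Z.N with hi | hi
    · obtain ⟨e1, e2⟩ := Z.knots_succ_eq h ⟨i, hi⟩
      simp only at e1 e2
      rw [e1, e2]
      exact hle _
    · exact (hstep i hi).le
  · rcases lt_or_ge i Z.N with hi | hi
    · obtain ⟨e1, e2⟩ := Z.knots_succ_eq h ⟨i, hi⟩
      simp only at e1 e2
      rw [e1, e2]
      exact hge _
    · rw [hstep i hi]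
      exact le_mul_of_one_le_left hh.le hσ

theorem mem_univariateSplines_iff {p k : ℕ} (Z : SplineGrid 0 1) (h : ℝ) (f : ℝ → ℝ) :
    f ∈ univariateSplines p k Z ↔ f ∈ splineSubmodule p k Z.N (Z.knots h) := by
  refine and_congr Iff.rfl ⟨fun hf i hi => ?_, fun hf i => ?_⟩
  · obtain ⟨e1, e2⟩ := Z.knots_succ_eq h ⟨i, hi⟩
    simp only at e1 e2
    rw [e1, e2]
    exact hf _
  · obtain ⟨e1, e2⟩ := Z.knots_succ_eq h i
    rw [← e1, ← e2]
    exact hf i i.2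

/-- A decomposition of the identity on univariate splines into local integral operators with
values in the splines. -/
theorem exists_local_kernels {p k : ℕ} (hk : k < p) {σ : ℝ} (hσ : 1 ≤ σ) :
    ∃ C : ℝ, 0 < C ∧ ∀ (h : ℝ) (Z : SplineGrid 0 1), 0 < h →
      (∀ i : Fin Z.N, Z.z i.succ - Z.z i.castSucc ≤ h) →
      (∀ i : Fin Z.N, h ≤ σ * (Z.z i.succ - Z.z i.castSucc)) →
      ∃ (n : ℕ) (K : Fin n → ℝ → ℝ → ℝ) (ξ : Fin n → ℝ), (∀ i, ξ i ∈ Icc (0 : ℝ) 1) ∧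
        (∀ i x, Measurable (K i x)) ∧
        (∀ x ∈ Icc (0 : ℝ) 1, ∀ y, ∑ i, |K i x y| ≤ C / h) ∧
        (∀ i, ∀ x ∈ Icc (0 : ℝ) 1, ∀ y, K i x y ≠ 0 → |x - ξ i| ≤ C * h ∧ |y - ξ i| ≤ C * h) ∧
        ∀ f ∈ univariateSplines p k Z,
          (∀ i x, IntegrableOn (fun y => K i x y * f y) (Ioo 0 1)) ∧
          (∀ i, (fun x => ∫ y in Ioo 0 1, K i x y * f y) ∈ univariateSplines p k Z) ∧
          ∀ x ∈ Icc (0 : ℝ) 1, ∑ i, ∫ y in Ioo 0 1, K i x y * f y = f x := by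
  obtain ⟨θ, hθ⟩ := exists_dual_polynomials p
  have hp : p ≠ 0 := by omega
  have hbd : ∀ b, ∃ Θ, ∀ t ∈ Icc (0 : ℝ) 1, |(θ b).eval t| ≤ Θ := fun b =>
    isCompact_Icc.exists_bound_of_continuousOn (θ b).continuous.continuousOn
  choose Θ' hΘ' using hbd
  have hΘ0' : ∀ b, 0 ≤ Θ' b := fun b => (abs_nonneg _).trans (hΘ' b 0 ⟨le_rfl, zero_le_one⟩)
  obtain ⟨Θ, hΘ⟩ : ∃ Θ, ∀ b, ∀ t ∈ Icc (0 : ℝ) 1, |(θ b).eval t| ≤ Θ :=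
    ⟨∑ b, Θ' b, fun b t ht => (hΘ' b t ht).trans
      (Finset.single_le_sum (f := Θ') (fun b _ => hΘ0' b) (Finset.mem_univ b))⟩
  have hΘ0 : 0 ≤ Θ := (abs_nonneg _).trans (hΘ 0 0 ⟨le_rfl, zero_le_one⟩)
  have hσ0 := zero_lt_one.trans_le hσ
  let B : ℝ := (p * σ) ^ p + (p + 1) * ((p * σ) ^ p * (p * σ) ^ p)
  have hB : 0 ≤ B := by positivity
  -- The first summand is the bound on the sum of the kernels, times $h$; the second is the
  -- localization radius in units of $h$.
  refine ⟨(p + 1) * (2 * ((p + 1) * (σ * Θ * B))) + (p + 2), by positivity, ?_⟩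
  intro h Z hh hle hge
  have H := Z.isKnotSequence hh hσ hle hge
  set τ := Z.knots h
  refine ⟨Z.N + 1, fun i => localKernel p Z.N θ τ i, fun i => τ (i - 1), fun i => ?_,
    fun i x => ?_, fun x hx y => ?_, fun i x hx y hne => ?_, fun f hf => ?_⟩
  · exact ⟨H.zero.ge.trans (H.strictMono.monotone (Nat.zero_le _)),
      (H.strictMono.monotone (show (i : ℕ) - 1 ≤ Z.N by omega)).trans H.last.le⟩
  · unfold localKernel
    dsimp only
    split_ifs
    · exact (measurable_cutoffKernel _ _ _).sub measurable_const
    · exact (measurable_cutoffKernel _ _ _).sub (measurable_cutoffKernel _ _ _)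
  · rw [Fin.sum_univ_eq_sum_range (fun i => |localKernel p Z.N θ τ i x y|)]
    refine (sum_abs_localKernel_le H hp hx
      (fun i => abs_cutoffKernel_le H hp hΘ i hx y) _).trans ?_
    rw [le_div_iff₀ hh]
    have : (p + 1) * (2 * ((p + 1) * (σ / h * Θ *
        ((p * σ) ^ p + (p + 1) * ((p * σ) ^ p * (p * σ) ^ p))))) * h =
        (p + 1) * (2 * ((p + 1) * (σ * Θ * B))) := by
      simp only [B]
      field_simp
    rw [this]
    exact le_add_of_nonneg_right (by positivity)
  · obtain ⟨h1, h2⟩ := abs_sub_knot_le_of_localKernel_ne_zero H hp hx hne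
    have h3 : ((p : ℝ) + 2) * h ≤ ((p + 1) * (2 * ((p + 1) * (σ * Θ * B))) + (p + 2)) * h :=
      mul_le_mul_of_nonneg_right (le_add_of_nonneg_left (by positivity)) hh.le
    exact ⟨h1.trans h3, h2.trans h3⟩
  · rw [mem_univariateSplines_iff Z h] at hf
    have hc := fun i x => integrableOn_cutoffKernel_mul H θ hf i x
    have hint : ∀ i x, IntegrableOn (fun y => localKernel p Z.N θ τ i x y * f y) (Ioo 0 1) := by
      intro i x
      simp only [localKernel, sub_mul]
      refine (hc i x).sub ?_
      split_ifs
      · simp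
      · exact hc _ x
    refine ⟨fun i x => hint i x, fun i => ?_, fun x hx => ?_⟩
    · rw [mem_univariateSplines_iff Z h]
      by_cases hi : (i : ℕ) = 0
      · simp only [localKernel, if_pos hi, sub_zero]
        exact integral_cutoffKernel_mem H hk hθ hf _
      · simp only [localKernel, if_neg hi, sub_mul]
        simp only [integral_sub (hc i _) (hc (i - 1) _)]
        exact Submodule.sub_mem _ (integral_cutoffKernel_mem H hk hθ hf _)
          (integral_cutoffKernel_mem H hk hθ hf _)
    · rw [Fin.sum_univ_eq_sum_range (fun i => ∫ y in Ioo 0 1, localKernel p Z.N θ τ i x y * f y),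
        ← integral_finsetSum _ fun i _ => hint i x]
      simp only [← Finset.sum_mul, sum_localKernel_eq]
      exact integral_cutoffKernel_last H hk hθ hf hx

/-! ### Lipschitz continuity from bounded weak derivatives -/

theorem isOpen_unitCube (d : ℕ) : IsOpen (unitCube d) :=
  isOpen_set_pi finite_univ fun _ _ => isOpen_Ioo

theorem volume_unitCube (d : ℕ) : volume (unitCube d) = 1 := by
  rw [unitCube, Real.volume_pi_Ioo]
  simp

/-- The mollification of a function on an open set has partial derivatives bounded by those of the
function. -/
theorem abs_fderiv_mollification_single_le {d : ℕ} {Q : Set (Fin d → ℝ)} (hQ : MeasurableSet Q)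
    {i : Fin d} {ρ g : (Fin d → ℝ) → ℝ} (hρ : IntegrableOn ρ Q) (hg : IsWeakPartialDeriv Q i ρ g)
    {M : ℝ} (hM : ∀ᵐ x ∂volume.restrict Q, |g x| ≤ M) (φ : ContDiffBump (0 : Fin d → ℝ))
    {x : Fin d → ℝ} (hx : Metric.closedBall x φ.rOut ⊆ Q) :
    |fderiv ℝ (convolution (φ.normed volume) (Q.indicator ρ)
      (ContinuousLinearMap.lsmul ℝ ℝ) volume) x (Pi.single i 1)| ≤ M := by
  set f := φ.normed volume with hf
  have hfs : ContDiff ℝ ∞ f := φ.contDiff_normed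
  have hfc : HasCompactSupport f := φ.hasCompactSupport_normed
  have hu : LocallyIntegrable (Q.indicator ρ) volume :=
    (hρ.integrable_indicator hQ).locallyIntegrable
  have hder := hfc.hasFDerivAt_convolution_left (ContinuousLinearMap.lsmul ℝ ℝ)
    (hfs.of_le (by exact_mod_cast le_top)) hu x
  have hcont : Continuous (fderiv ℝ f) := hfs.continuous_fderiv (by simp)
  have hex : ConvolutionExistsAt (fderiv ℝ f) (Q.indicator ρ) x
      (ContinuousLinearMap.precompL (Fin d → ℝ) (ContinuousLinearMap.lsmul ℝ ℝ)) volume :=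
    (hfc.fderiv ℝ).convolutionExists_left _ hcont hu x
  let ψ : (Fin d → ℝ) → ℝ := fun t => f (x - t)
  have hψs : ContDiff ℝ ∞ ψ := hfs.comp (contDiff_const.sub contDiff_id)
  have hψsupp : Function.support ψ ⊆ Metric.closedBall x φ.rOut := by
    intro t ht
    have : x - t ∈ Function.support f := ht
    rw [hf, φ.support_normed_eq, mem_ball_zero_iff] at this
    rw [Metric.mem_closedBall, dist_comm, dist_eq_norm]
    exact this.le
  have hψt : tsupport ψ ⊆ Metric.closedBall x φ.rOut :=
    closure_minimal hψsupp Metric.isClosed_closedBall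
  have hψc : HasCompactSupport ψ :=
    (isCompact_closedBall x φ.rOut).of_isClosed_subset (isClosed_tsupport _) hψt
  have hψd : ∀ t, fderiv ℝ ψ t (Pi.single i 1) = -(fderiv ℝ f (x - t) (Pi.single i 1)) := by
    intro t
    have h1 : HasFDerivAt ψ ((fderiv ℝ f (x - t)).comp (-ContinuousLinearMap.id ℝ _)) t :=
      ((hfs.differentiable (by simp)) (x - t)).hasFDerivAt.comp t
        ((hasFDerivAt_id t).const_sub x)
    rw [h1.fderiv]
    simp
  have hint : Integrable ψ volume := hψs.continuous.integrable_of_hasCompactSupport hψc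
  -- The reflected bump `ψ` is supported in `Q`, hence a valid test function: the derivative moves
  -- from the mollifier to $\rho$.
  have hkey : fderiv ℝ (convolution f (Q.indicator ρ) (ContinuousLinearMap.lsmul ℝ ℝ) volume) x
      (Pi.single i 1) = ∫ t in Q, g t * ψ t := by
    rw [hder.fderiv, convolution, ContinuousLinearMap.integral_apply hex]
    simp only [ContinuousLinearMap.precompL_apply, ContinuousLinearMap.lsmul_apply, smul_eq_mul]
    rw [← integral_sub_left_eq_self (fun t => fderiv ℝ f t (Pi.single i 1) *
      Q.indicator ρ (x - t)) volume x]
    simp only [sub_sub_cancel]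
    have h2 := hg.2.2 ψ hψs hψc (hψt.trans hx)
    rw [← neg_eq_iff_eq_neg.2 h2, ← integral_neg, ← integral_indicator hQ]
    refine integral_congr_ae (Filter.Eventually.of_forall fun t => ?_)
    by_cases ht : t ∈ Q
    · simp only [indicator_of_mem ht, hψd]
      ring
    · simp only [indicator_of_notMem ht, mul_zero]
  rw [hkey]
  have hψ0 : ∀ t, 0 ≤ ψ t := fun t => φ.nonneg_normed (μ := volume) (x - t)
  calc |∫ t in Q, g t * ψ t| ≤ ∫ t in Q, M * ψ t := by
        rw [← Real.norm_eq_abs]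
        refine norm_integral_le_of_norm_le (hint.integrableOn.const_mul M) ?_
        filter_upwards [hM] with t ht
        rw [Real.norm_eq_abs, abs_mul, abs_of_nonneg (hψ0 t)]
        exact mul_le_mul_of_nonneg_right ht (hψ0 t)
    _ = M * ∫ t in Q, ψ t := integral_const_mul _ _
    _ = M * ∫ t, ψ t := by
        rw [setIntegral_eq_integral_of_forall_compl_eq_zero]
        intro t ht
        by_contra hne
        exact ht (hx (hψsupp hne))
    _ = M := by
        rw [show ∫ t, ψ t = 1 from (integral_sub_left_eq_self f volume x).trans
          (φ.integral_normed), mul_one]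

/-- The domain carries the maximum norm, whose dual norm is the sum of the absolute values of the
coefficients. -/
theorem norm_fderiv_le_of_single {d : ℕ} (A : (Fin d → ℝ) →L[ℝ] ℝ) {M : Fin d → ℝ}
    (hA : ∀ i, |A (Pi.single i 1)| ≤ M i) : ‖A‖ ≤ ∑ i, M i := by
  have hM0 : ∀ i, 0 ≤ M i := fun i => (abs_nonneg _).trans (hA i)
  refine A.opNorm_le_bound (Finset.sum_nonneg fun i _ => hM0 i) fun v => ?_
  have hv : A v = ∑ i, v i * A (Pi.single i 1) := by
    conv_lhs => rw [← Finset.univ_sum_single v, map_sum]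
    refine Finset.sum_congr rfl fun i _ => ?_
    rw [show (Pi.single i (v i) : Fin d → ℝ) = v i • Pi.single i 1 by
      rw [← Pi.single_smul', smul_eq_mul, mul_one], map_smul, smul_eq_mul]
  rw [hv, Finset.sum_mul]
  refine (norm_sum_le _ _).trans (Finset.sum_le_sum fun i _ => ?_)
  rw [norm_mul, mul_comm]
  exact mul_le_mul (hA i) (norm_le_pi_norm v i) (norm_nonneg _) (hM0 i)

/-- A function on the unit cube with bounded weak derivatives is Lipschitz off a null set. -/
theorem exists_lipschitz_of_weakPartialDeriv {d : ℕ} {ρ : (Fin d → ℝ) → ℝ}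
    (hρ : IntegrableOn ρ (unitCube d)) {g : Fin d → (Fin d → ℝ) → ℝ}
    (hg : ∀ i, IsWeakPartialDeriv (unitCube d) i ρ (g i)) {M : Fin d → ℝ}
    (hM : ∀ i, ∀ᵐ x ∂volume.restrict (unitCube d), |g i x| ≤ M i) :
    ∃ G ⊆ unitCube d, (∀ᵐ x ∂volume.restrict (unitCube d), x ∈ G) ∧
      ∀ x ∈ G, ∀ y ∈ G, |ρ x - ρ y| ≤ (∑ i, M i) * ‖x - y‖ := by
  set Q := unitCube d with hQdef
  have hQ : MeasurableSet Q := (isOpen_unitCube d).measurableSet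
  let φ : ℕ → ContDiffBump (0 : Fin d → ℝ) := fun n =>
    ⟨1 / ((n : ℝ) + 1) / 2, 1 / ((n : ℝ) + 1), by positivity,
      half_lt_self (by positivity)⟩
  have hφ : Filter.Tendsto (fun n => (φ n).rOut) Filter.atTop (nhds 0) :=
    tendsto_one_div_add_atTop_nhds_zero_nat
  let F : ℕ → (Fin d → ℝ) → ℝ := fun n => convolution ((φ n).normed volume) (Q.indicator ρ)
    (ContinuousLinearMap.lsmul ℝ ℝ) volume
  have hlim : ∀ᵐ x, Filter.Tendsto (fun n => F n x) Filter.atTop (nhds (Q.indicator ρ x)) := by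
    refine ContDiffBump.ae_convolution_tendsto_right_of_locallyIntegrable (K := 2) hφ
      (Filter.Eventually.of_forall fun n => ?_) (hρ.integrable_indicator hQ).locallyIntegrable
    change 1 / ((n : ℝ) + 1) ≤ 2 * (1 / ((n : ℝ) + 1) / 2)
    linarith
  refine ⟨{x | x ∈ Q ∧ Filter.Tendsto (fun n => F n x) Filter.atTop (nhds (ρ x))},
    fun x hx => hx.1, ?_, ?_⟩
  · filter_upwards [ae_restrict_of_ae hlim, ae_restrict_mem hQ] with x hx hxQ
    rw [indicator_of_mem hxQ] at hx
    exact ⟨hxQ, hx⟩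
  · rintro x ⟨hxQ, hx⟩ y ⟨hyQ, hy⟩
    refine le_of_tendsto (hx.sub hy).abs ?_
    -- On the cube shrunk by the mollification radius the gradient bound holds. This cube is convex
    -- and eventually contains both points, so the mean value inequality applies to `F n` and passes
    -- to the limit.
    have hin : ∀ z ∈ Q, ∀ᶠ n in Filter.atTop,
        z ∈ Set.pi univ fun _ => Ioo (φ n).rOut (1 - (φ n).rOut) := by
      intro z hz
      simp only [Set.mem_pi, mem_univ, true_imp_iff]
      refine Filter.eventually_all.2 fun j => ?_
      have hzj : z j ∈ Ioo (0 : ℝ) 1 := hz j (mem_univ j)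
      filter_upwards [hφ.eventually (gt_mem_nhds hzj.1),
        hφ.eventually (gt_mem_nhds (sub_pos.2 hzj.2))] with n h1 h2
      exact ⟨h1, by linarith⟩
    filter_upwards [hin x hxQ, hin y hyQ] with n hxn hyn
    rw [← Real.norm_eq_abs]
    have hconv : Convex ℝ (Set.pi univ fun _ : Fin d => Ioo (φ n).rOut (1 - (φ n).rOut)) :=
      convex_pi fun _ _ => convex_Ioo _ _
    refine hconv.norm_image_sub_le_of_norm_fderiv_le (𝕜 := ℝ) (f := F n) (fun z _ => ?_)
      (fun z hz => ?_) hyn hxn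
    · exact ((φ n).hasCompactSupport_normed.hasFDerivAt_convolution_left
        (ContinuousLinearMap.lsmul ℝ ℝ) (φ n).contDiff_normed
        (hρ.integrable_indicator hQ).locallyIntegrable z).differentiableAt
    · refine norm_fderiv_le_of_single _ fun i =>
        abs_fderiv_mollification_single_le hQ hρ (hg i) (hM i) (φ n) fun t ht j _ => ?_
      have h1 : |t j - z j| ≤ (φ n).rOut :=
        (norm_le_pi_norm (t - z) j).trans (by rwa [← dist_eq_norm])
      have h2 := hz j (mem_univ j)
      have h3 := abs_le.1 h1
      exact ⟨by linarith [h2.1], by linarith [h2.2]⟩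

/-! ### Schur's test -/

/-- Schur's test for the boundedness of a positive integral operator on `L²`. -/
theorem lintegral_sq_lintegral_mul_le {α : Type*} [MeasurableSpace α] {μ : Measure α} [SFinite μ]
    {κ : α → α → ℝ≥0∞} (hκ : Measurable (Function.uncurry κ)) {A : ℝ≥0∞}
    (h1 : ∀ x, ∫⁻ y, κ x y ∂μ ≤ A) (h2 : ∀ y, ∫⁻ x, κ x y ∂μ ≤ A) {g : α → ℝ≥0∞}
    (hg : AEMeasurable g μ) :
    ∫⁻ x, (∫⁻ y, κ x y * g y ∂μ) ^ (2 : ℝ) ∂μ ≤ A ^ (2 : ℝ) * ∫⁻ y, g y ^ (2 : ℝ) ∂μ := by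
  have hκx : ∀ x, Measurable (κ x) := fun x => hκ.comp measurable_prodMk_left
  -- Cauchy–Schwarz for $\kappa g=\kappa^{1/2}\cdot\kappa^{1/2}g$.
  have hCS : ∀ x, (∫⁻ y, κ x y * g y ∂μ) ^ (2 : ℝ) ≤ A * ∫⁻ y, κ x y * g y ^ (2 : ℝ) ∂μ := by
    intro x
    have hH := ENNReal.lintegral_mul_le_Lp_mul_Lq μ Real.HolderConjugate.two_two
      (f := fun y => κ x y ^ (1 / 2 : ℝ)) (g := fun y => κ x y ^ (1 / 2 : ℝ) * g y)
      ((hκx x).pow_const _).aemeasurable (((hκx x).pow_const _).aemeasurable.mul hg)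
    have e1 : ∀ y, ((fun y => κ x y ^ (1 / 2 : ℝ)) * fun y => κ x y ^ (1 / 2 : ℝ) * g y) y =
        κ x y * g y := by
      intro y
      rw [Pi.mul_apply, ← mul_assoc, ← ENNReal.rpow_add_of_nonneg _ _ (by norm_num) (by norm_num)]
      norm_num
    have e2 : ∀ y, (κ x y ^ (1 / 2 : ℝ)) ^ (2 : ℝ) = κ x y := by
      intro y
      rw [← ENNReal.rpow_mul]
      norm_num
    simp only [e1, e2, ENNReal.mul_rpow_of_nonneg _ _ (zero_le_two (α := ℝ))] at hH
    calc (∫⁻ y, κ x y * g y ∂μ) ^ (2 : ℝ)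
        ≤ ((∫⁻ y, κ x y ∂μ) ^ (1 / 2 : ℝ) *
            (∫⁻ y, κ x y * g y ^ (2 : ℝ) ∂μ) ^ (1 / 2 : ℝ)) ^ (2 : ℝ) :=
          ENNReal.rpow_le_rpow hH zero_le_two
      _ = (∫⁻ y, κ x y ∂μ) * ∫⁻ y, κ x y * g y ^ (2 : ℝ) ∂μ := by
          rw [ENNReal.mul_rpow_of_nonneg _ _ zero_le_two, ← ENNReal.rpow_mul, ← ENNReal.rpow_mul]
          norm_num
      _ ≤ A * ∫⁻ y, κ x y * g y ^ (2 : ℝ) ∂μ := mul_le_mul_left (h1 x) _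
  have hmeas : AEMeasurable (Function.uncurry fun x y => κ x y * g y ^ (2 : ℝ)) (μ.prod μ) :=
    hκ.aemeasurable.mul
      ((hg.pow_const (2 : ℝ)).comp_quasiMeasurePreserving Measure.quasiMeasurePreserving_snd)
  calc ∫⁻ x, (∫⁻ y, κ x y * g y ∂μ) ^ (2 : ℝ) ∂μ
      ≤ ∫⁻ x, A * ∫⁻ y, κ x y * g y ^ (2 : ℝ) ∂μ ∂μ := lintegral_mono hCS
    _ = A * ∫⁻ x, ∫⁻ y, κ x y * g y ^ (2 : ℝ) ∂μ ∂μ :=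
        lintegral_const_mul'' _ hmeas.lintegral_prod_right'
    _ = A * ∫⁻ y, ∫⁻ x, κ x y * g y ^ (2 : ℝ) ∂μ ∂μ := by rw [lintegral_lintegral_swap hmeas]
    _ = A * ∫⁻ y, (∫⁻ x, κ x y ∂μ) * g y ^ (2 : ℝ) ∂μ := by
        congr 1
        refine lintegral_congr fun y => ?_
        exact lintegral_mul_const _ (hκ.comp measurable_prodMk_right)
    _ ≤ A * ∫⁻ y, A * g y ^ (2 : ℝ) ∂μ := by
        gcongr with y
        exact h2 y
    _ = A ^ (2 : ℝ) * ∫⁻ y, g y ^ (2 : ℝ) ∂μ := by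
        rw [lintegral_const_mul'' _ (hg.pow_const _), ← mul_assoc, ENNReal.rpow_two, sq]

/-- The Lipschitz bound holds only on the full-measure set `G`, so $\rho$ must be sampled there. A
ball around a point of the closed cube meets the open cube in positive measure, hence meets `G`. -/
theorem exists_mem_near {d : ℕ} {G : Set (Fin d → ℝ)}
    (hG : ∀ᵐ x ∂volume.restrict (unitCube d), x ∈ G) {ξ : Fin d → ℝ}
    (hξ : ∀ j, ξ j ∈ Icc (0 : ℝ) 1) {r : ℝ} (hr : 0 < r) : ∃ y ∈ G, ‖y - ξ‖ ≤ r := by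
  by_contra hcon
  push Not at hcon
  have hcl : ξ ∈ closure (unitCube d) := by
    rw [unitCube, closure_pi_set]
    intro j _
    rw [closure_Ioo zero_ne_one]
    exact hξ j
  have hne : (Metric.ball ξ r ∩ unitCube d).Nonempty :=
    mem_closure_iff.1 hcl _ Metric.isOpen_ball (Metric.mem_ball_self hr)
  have hpos := (Metric.isOpen_ball.inter (isOpen_unitCube d)).measure_pos volume hne
  rw [← Measure.restrict_apply Metric.isOpen_ball.measurableSet] at hpos
  have hsub : Metric.ball ξ r ⊆ Gᶜ := fun x hx hxG => by
    have := hcon x hxG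
    rw [Metric.mem_ball, dist_eq_norm] at hx
    exact lt_asymm this hx
  exact hpos.ne' (measure_mono_null hsub hG)

/-! ### Tensor products and the pointwise error bound -/

section tensor

variable {d p k : ℕ} {Z : Fin d → SplineGrid 0 1} {n : Fin d → ℕ}
  {K : ∀ j, Fin (n j) → ℝ → ℝ → ℝ} {w : (Fin d → ℝ) → ℝ}

theorem restrict_unitCube (d : ℕ) : (volume : Measure (Fin d → ℝ)).restrict (unitCube d) =
    Measure.pi fun _ => (volume : Measure ℝ).restrict (Ioo 0 1) := by
  rw [unitCube, volume_pi, Measure.restrict_pi_pi]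

theorem continuousOn_of_mem_tensorSplineSpace (hw : w ∈ tensorSplineSpace p k Z) :
    ContinuousOn w (unitCube d) := by
  induction hw using Submodule.span_induction with
  | mem w hw =>
    obtain ⟨f, hf, rfl⟩ := hw
    refine continuousOn_finsetProd _ fun j _ => ?_
    exact (hf j).1.continuousOn.comp (continuous_apply j).continuousOn fun x hx => hx j trivial
  | zero => exact continuousOn_const
  | add u v _ _ hu hv => exact hu.add hv
  | smul c u _ hu => exact hu.const_smul c

theorem exists_bound_of_mem_univariateSplines {f : ℝ → ℝ} {Y : SplineGrid 0 1}
    {h σ : ℝ} (H : IsKnotSequence Y.N h σ (Y.knots h)) (hf : f ∈ univariateSplines p k Y) :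
    ∃ B, ∀ x ∈ Icc (0 : ℝ) 1, |f x| ≤ B := by
  have hb : ∀ i : Fin Y.N, ∃ B, ∀ x ∈ Icc (Y.knots h i) (Y.knots h (i + 1)), |f x| ≤ B := by
    intro i
    obtain ⟨q, -, hq⟩ := ((mem_univariateSplines_iff Y h f).1 hf).2 i i.2
    obtain ⟨B, hB⟩ := (isCompact_Icc (a := Y.knots h i)
      (b := Y.knots h (i + 1))).exists_bound_of_continuousOn q.continuous.continuousOn
    exact ⟨B, fun x hx => by rw [hq x hx]; exact hB x hx⟩
  choose B hB using hb
  refine ⟨∑ i, |B i|, fun x hx => ?_⟩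
  have hl := spanIndex_lt (x := x) H
  refine (hB ⟨_, hl⟩ x (mem_span_spanIndex H hx)).trans ((le_abs_self _).trans ?_)
  exact Finset.single_le_sum (f := fun i => |B i|) (fun i _ => abs_nonneg _) (Finset.mem_univ _)

/-- Boundedness makes the $L^2$ norm of a spline finite, which the final limit requires. -/
theorem exists_bound_of_mem_tensorSplineSpace {h σ : ℝ}
    (H : ∀ j, IsKnotSequence (Z j).N h σ ((Z j).knots h)) (hw : w ∈ tensorSplineSpace p k Z) :
    ∃ B, ∀ x ∈ unitCube d, |w x| ≤ B := by
  induction hw using Submodule.span_induction with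
  | mem w hw =>
    obtain ⟨f, hf, rfl⟩ := hw
    choose B hB using fun j => exists_bound_of_mem_univariateSplines (H j) (hf j)
    refine ⟨∏ j, B j, fun x hx => ?_⟩
    rw [Finset.abs_prod]
    exact Finset.prod_le_prod (fun _ _ => abs_nonneg _) fun j _ =>
      hB j _ (Ioo_subset_Icc_self (hx j trivial))
  | zero => exact ⟨0, fun x _ => by simp⟩
  | add u v _ _ hu hv =>
    obtain ⟨B, hB⟩ := hu
    obtain ⟨B', hB'⟩ := hv
    exact ⟨B + B', fun x hx => (abs_add_le _ _).trans (add_le_add (hB x hx) (hB' x hx))⟩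
  | smul c u _ hu =>
    obtain ⟨B, hB⟩ := hu
    exact ⟨|c| * B, fun x hx => by
      rw [Pi.smul_apply, smul_eq_mul, abs_mul]
      exact mul_le_mul_of_nonneg_left (hB x hx) (abs_nonneg _)⟩

/-- Tensor products of local kernels decompose the tensor-product splines. -/
theorem tensor_kernel_decomposition
    (hK : ∀ j, ∀ f ∈ univariateSplines p k (Z j),
      (∀ i x, IntegrableOn (fun y => K j i x y * f y) (Ioo 0 1)) ∧
      (∀ i, (fun x => ∫ y in Ioo 0 1, K j i x y * f y) ∈ univariateSplines p k (Z j)) ∧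
      ∀ x ∈ Icc (0 : ℝ) 1, ∑ i, ∫ y in Ioo 0 1, K j i x y * f y = f x)
    (hw : w ∈ tensorSplineSpace p k Z) :
    (∀ (I : ∀ j, Fin (n j)) (x : Fin d → ℝ),
      IntegrableOn (fun y => (∏ j, K j (I j) (x j) (y j)) * w y) (unitCube d)) ∧
    (∀ I : ∀ j, Fin (n j), (fun x : Fin d → ℝ => ∫ y in unitCube d, (∏ j, K j (I j) (x j) (y j)) * w y) ∈
      tensorSplineSpace p k Z) ∧
    ∀ x ∈ unitCube d, ∑ I : ∀ j, Fin (n j),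
      ∫ y in unitCube d, (∏ j, K j (I j) (x j) (y j)) * w y = w x := by
  induction hw using Submodule.span_induction with
  | mem w hw =>
    obtain ⟨f, hf, rfl⟩ := hw
    simp only [← Finset.prod_mul_distrib]
    have hprod : ∀ (I : ∀ j, Fin (n j)) (x : Fin d → ℝ),
        ∫ y in unitCube d, ∏ j, K j (I j) (x j) (y j) * f j (y j) =
          ∏ j, ∫ t in Ioo 0 1, K j (I j) (x j) t * f j t := by
      intro I x
      rw [restrict_unitCube]
      exact integral_fintype_prod_eq_prod fun j t => K j (I j) (x j) t * f j t
    refine ⟨fun I x => ?_, fun I => ?_, fun x hx => ?_⟩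
    · rw [IntegrableOn, restrict_unitCube]
      exact Integrable.fintype_prod (f := fun j t => K j (I j) (x j) t * f j t)
        fun j => ((hK j _ (hf j)).1 (I j) (x j))
    · simp only [hprod]
      exact Submodule.subset_span ⟨fun j t => ∫ y in Ioo 0 1, K j (I j) t y * f j y,
        fun j => (hK j _ (hf j)).2.1 (I j), rfl⟩
    · simp only [hprod]
      -- Summing over all multi-indices factors into the univariate decompositions of the identity.
      rw [← Fintype.prod_sum fun j i => ∫ t in Ioo 0 1, K j i (x j) t * f j t]
      exact Finset.prod_congr rfl fun j _ =>
        (hK j _ (hf j)).2.2 _ (Ioo_subset_Icc_self (hx j trivial))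
  | zero =>
    simp only [Pi.zero_apply, mul_zero, integral_zero, Finset.sum_const_zero, implies_true,
      and_true]
    exact ⟨fun _ _ => integrableOn_zero, fun _ => Submodule.zero_mem _⟩
  | add u v _ _ hu hv =>
    simp only [Pi.add_apply, mul_add]
    refine ⟨fun I x => (hu.1 I x).add (hv.1 I x), fun I => ?_, fun x hx => ?_⟩
    · simp only [integral_add (hu.1 I _) (hv.1 I _)]
      exact Submodule.add_mem _ (hu.2.1 I) (hv.2.1 I)
    · simp only [integral_add (hu.1 _ _) (hv.1 _ _), Finset.sum_add_distrib]
      rw [hu.2.2 x hx, hv.2.2 x hx]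
  | smul c u _ hu =>
    simp only [Pi.smul_apply, smul_eq_mul, mul_left_comm _ c, integral_const_mul]
    refine ⟨fun I x => (hu.1 I x).const_mul c, fun I => ?_, fun x hx => ?_⟩
    · exact Submodule.smul_mem _ c (hu.2.1 I)
    · rw [← Finset.mul_sum, hu.2.2 x hx]

/-- The kernel that dominates the local approximation error. -/
noncomputable def boxKernel (d : ℕ) (C h : ℝ) (x y : Fin d → ℝ) : ℝ≥0∞ :=
  {q : (Fin d → ℝ) × (Fin d → ℝ) | dist q.1 q.2 ≤ 2 * (C * h)}.indicator
    (fun _ => ENNReal.ofReal ((C / h) ^ d)) (x, y)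

theorem measurable_boxKernel (d : ℕ) (C h : ℝ) : Measurable (Function.uncurry (boxKernel d C h)) :=
  measurable_const.indicator (measurableSet_le measurable_dist measurable_const)

theorem boxKernel_comm (C h : ℝ) (x y : Fin d → ℝ) : boxKernel d C h x y = boxKernel d C h y x := by
  simp only [boxKernel, indicator, mem_ofPred_eq, dist_comm]

/-- A maximum-norm ball of radius $2Ch$ has volume $(4Ch)^d$, so the height $(C/h)^d$ cancels every
power of $h$. -/
theorem lintegral_boxKernel_le {C h : ℝ} (hC : 0 < C) (hh : 0 < h) (x : Fin d → ℝ)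
    (Q : Set (Fin d → ℝ)) :
    ∫⁻ y in Q, boxKernel d C h x y ≤ ENNReal.ofReal ((4 * C ^ 2) ^ d) := by
  have heq : (fun y => boxKernel d C h x y) = (Metric.closedBall x (2 * (C * h))).indicator
      fun _ => ENNReal.ofReal ((C / h) ^ d) := by
    funext y
    simp only [boxKernel, indicator, mem_ofPred_eq, Metric.mem_closedBall, dist_comm]
  refine (lintegral_mono' Measure.restrict_le_self le_rfl).trans ?_
  rw [heq, lintegral_indicator Metric.isClosed_closedBall.measurableSet, setLIntegral_const,
    Real.volume_pi_closedBall _ (by positivity), ← ENNReal.ofReal_mul (by positivity),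
    Fintype.card_fin, ← mul_pow]
  refine ENNReal.ofReal_le_ofReal (le_of_eq ?_)
  congr 1
  field_simp
  ring

/-- The error of the local approximation is dominated pointwise by an integral operator. -/
theorem exists_enorm_mul_sub_le {C h L : ℝ} (hC : 0 < C) (hh : 0 < h) (hL : 0 ≤ L)
    {ξ : ∀ j, Fin (n j) → ℝ} (hξ : ∀ j i, ξ j i ∈ Icc (0 : ℝ) 1)
    (hsum : ∀ j, ∀ x ∈ Icc (0 : ℝ) 1, ∀ y, ∑ i, |K j i x y| ≤ C / h)
    (hloc : ∀ j i, ∀ x ∈ Icc (0 : ℝ) 1, ∀ y, K j i x y ≠ 0 →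
      |x - ξ j i| ≤ C * h ∧ |y - ξ j i| ≤ C * h)
    (hmeas : ∀ j i x, Measurable (K j i x))
    (hK : ∀ j, ∀ f ∈ univariateSplines p k (Z j),
      (∀ i x, IntegrableOn (fun y => K j i x y * f y) (Ioo 0 1)) ∧
      (∀ i, (fun x => ∫ y in Ioo 0 1, K j i x y * f y) ∈ univariateSplines p k (Z j)) ∧
      ∀ x ∈ Icc (0 : ℝ) 1, ∑ i, ∫ y in Ioo 0 1, K j i x y * f y = f x)
    (hw : w ∈ tensorSplineSpace p k Z) {ρ : (Fin d → ℝ) → ℝ} {G : Set (Fin d → ℝ)}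
    (hGQ : G ⊆ unitCube d) (hG : ∀ᵐ x ∂volume.restrict (unitCube d), x ∈ G)
    (hρ : ∀ x ∈ G, ∀ y ∈ G, |ρ x - ρ y| ≤ L * ‖x - y‖) :
    ∃ v ∈ tensorSplineSpace p k Z, ∀ x ∈ G, ‖ρ x * w x - v x‖ₑ ≤
      ENNReal.ofReal (L * ((C + 1) * h)) *
        ∫⁻ y in unitCube d, boxKernel d C h x y * ‖w y‖ₑ := by
  obtain ⟨hint, hmem, hrep⟩ := tensor_kernel_decomposition hK hw
  -- The sample point may miss the centre by $h$, whence the factor $C+1$ in place of $C$.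
  choose y₀ hy₀G hy₀ using fun I : ∀ j, Fin (n j) =>
    exists_mem_near hG (ξ := fun j => ξ j (I j)) (fun j => hξ j (I j)) hh
  let T : (∀ j, Fin (n j)) → (Fin d → ℝ) → ℝ := fun I x =>
    ∫ y in unitCube d, (∏ j, K j (I j) (x j) (y j)) * w y
  refine ⟨∑ I, ρ (y₀ I) • T I, Submodule.sum_mem _ fun I _ => Submodule.smul_mem _ _ (hmem I),
    fun x hx => ?_⟩
  have hxQ := hGQ hx
  have hxI : ∀ j, x j ∈ Icc (0 : ℝ) 1 := fun j => Ioo_subset_Icc_self (hxQ j trivial)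
  have hnear : ∀ (I : ∀ j, Fin (n j)) (y : Fin d → ℝ), (∏ j, K j (I j) (x j) (y j)) ≠ 0 →
      ‖x - fun j => ξ j (I j)‖ ≤ C * h ∧ ‖y - fun j => ξ j (I j)‖ ≤ C * h := by
    intro I y hne
    have hne' := fun j => hloc j (I j) _ (hxI j) (y j) (Finset.prod_ne_zero_iff.1 hne j
      (Finset.mem_univ j))
    have hCh : 0 ≤ C * h := by positivity
    exact ⟨(pi_norm_le_iff_of_nonneg hCh).2 fun j => (hne' j).1,
      (pi_norm_le_iff_of_nonneg hCh).2 fun j => (hne' j).2⟩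
  have hterm : ∀ (I : ∀ j, Fin (n j)) (y : Fin d → ℝ), |(ρ x - ρ (y₀ I)) * ∏ j, K j (I j) (x j) (y j)| ≤
      L * ((C + 1) * h) * ∏ j, |K j (I j) (x j) (y j)| := by
    intro I y
    rw [abs_mul, Finset.abs_prod]
    by_cases hne : ∏ j, K j (I j) (x j) (y j) = 0
    · rw [← Finset.abs_prod, hne]; simp
    refine mul_le_mul_of_nonneg_right ((hρ x hx _ (hy₀G I)).trans
      (mul_le_mul_of_nonneg_left ?_ hL)) (Finset.prod_nonneg fun _ _ => abs_nonneg _)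
    calc ‖x - y₀ I‖ ≤ ‖x - fun j => ξ j (I j)‖ + ‖(fun j => ξ j (I j)) - y₀ I‖ :=
          norm_sub_le_norm_sub_add_norm_sub _ _ _
      _ ≤ C * h + h := add_le_add (hnear I y hne).1 (by rw [norm_sub_rev]; exact hy₀ I)
      _ = (C + 1) * h := by ring
  -- The sum of products is a product of $d$ univariate sums, each at most $C/h$. A nonzero term
  -- puts $x$ and $y$ within $Ch$ of a common centre.
  have hbox : ∀ y, ENNReal.ofReal (∑ I : ∀ j, Fin (n j), ∏ j, |K j (I j) (x j) (y j)|) ≤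
      boxKernel d C h x y := by
    intro y
    by_cases hdist : dist x y ≤ 2 * (C * h)
    · rw [boxKernel, indicator_of_mem (by exact hdist)]
      refine ENNReal.ofReal_le_ofReal ?_
      rw [← Fintype.prod_sum fun j i => |K j i (x j) (y j)|]
      refine (Finset.prod_le_prod (fun j _ => Finset.sum_nonneg fun i _ => abs_nonneg _)
        fun j _ => hsum j _ (hxI j) (y j)).trans_eq ?_
      rw [Finset.prod_const, Finset.card_univ, Fintype.card_fin]
    · rw [Finset.sum_eq_zero, ENNReal.ofReal_zero]
      · exact zero_le
      intro I _
      by_contra hne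
      rw [← Finset.abs_prod, abs_eq_zero] at hne
      obtain ⟨e1, e2⟩ := hnear I y hne
      refine hdist ?_
      rw [dist_eq_norm]
      have e3 := norm_sub_le_norm_sub_add_norm_sub x (fun j => ξ j (I j)) y
      rw [norm_sub_rev (fun j => ξ j (I j)) y] at e3
      linarith
  have hwm : AEMeasurable w (volume.restrict (unitCube d)) :=
    (continuousOn_of_mem_tensorSplineSpace hw).aemeasurable (isOpen_unitCube d).measurableSet
  have hKm : ∀ I : ∀ j, Fin (n j), Measurable fun y : Fin d → ℝ => ∏ j, K j (I j) (x j) (y j) :=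
    fun I => Finset.measurable_fun_prod _ fun j _ => (hmeas j (I j) (x j)).comp
      (measurable_pi_apply j)
  have hsplit : ρ x * w x - (∑ I, ρ (y₀ I) • T I) x = ∑ I, (ρ x - ρ (y₀ I)) * T I x := by
    rw [← hrep x hxQ, Finset.mul_sum, Finset.sum_apply, ← Finset.sum_sub_distrib]
    exact Finset.sum_congr rfl fun I _ => (sub_mul _ _ _).symm
  rw [hsplit]
  calc ‖∑ I, (ρ x - ρ (y₀ I)) * T I x‖ₑ
      ≤ ∑ I, ‖(ρ x - ρ (y₀ I)) * T I x‖ₑ := enorm_sum_le _ _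
    _ ≤ ∑ I, ∫⁻ y in unitCube d,
          ‖(ρ x - ρ (y₀ I)) * ((∏ j, K j (I j) (x j) (y j)) * w y)‖ₑ := by
        refine Finset.sum_le_sum fun I _ => ?_
        simp only [T]
        rw [← integral_const_mul]
        exact enorm_integral_le_lintegral_enorm _
    _ = ∫⁻ y in unitCube d, ∑ I,
          ‖(ρ x - ρ (y₀ I)) * ((∏ j, K j (I j) (x j) (y j)) * w y)‖ₑ := by
        refine (lintegral_finsetSum' _ fun I _ => ?_).symm
        exact (((hKm I).aemeasurable.mul hwm).const_mul _).enorm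
    _ ≤ ∫⁻ y in unitCube d, ENNReal.ofReal (L * ((C + 1) * h)) *
          (boxKernel d C h x y * ‖w y‖ₑ) := by
        refine lintegral_mono fun y => ?_
        rw [← mul_assoc]
        simp only [← mul_assoc (ρ x - _), enorm_mul _ (w y)]
        rw [← Finset.sum_mul]
        refine mul_le_mul_left ?_ _
        calc ∑ I, ‖(ρ x - ρ (y₀ I)) * ∏ j, K j (I j) (x j) (y j)‖ₑ
            ≤ ∑ I : ∀ j, Fin (n j),
              ENNReal.ofReal (L * ((C + 1) * h) * ∏ j, |K j (I j) (x j) (y j)|) := by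
              refine Finset.sum_le_sum fun I _ => ?_
              rw [Real.enorm_eq_ofReal_abs]
              exact ENNReal.ofReal_le_ofReal (hterm I y)
          _ = ENNReal.ofReal (L * ((C + 1) * h)) *
              ENNReal.ofReal (∑ I : ∀ j, Fin (n j), ∏ j, |K j (I j) (x j) (y j)|) := by
              rw [← ENNReal.ofReal_mul (by positivity), Finset.mul_sum,
                ENNReal.ofReal_sum_of_nonneg]
              exact fun I _ => mul_nonneg (by positivity)
                (Finset.prod_nonneg fun _ _ => abs_nonneg _)
          _ ≤ ENNReal.ofReal (L * ((C + 1) * h)) * boxKernel d C h x y :=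
              mul_le_mul_right (hbox y) _
    _ = _ := lintegral_const_mul' _ _ ENNReal.ofReal_ne_top

end tensor

/-! ### The $L^2$ estimate and the conclusion -/

theorem normL2Cube_eq {d : ℕ} (u : (Fin d → ℝ) → ℝ) :
    normL2Cube u = (∫⁻ x in unitCube d, ‖u x‖ₑ ^ (2 : ℝ)) ^ (1 / 2 : ℝ) := by
  rw [normL2Cube, eLpNorm_eq_lintegral_rpow_enorm_toReal two_ne_zero ENNReal.ofNat_ne_top]
  simp

theorem normL2Cube_le_of_ae_le {d : ℕ} {C h b : ℝ} (hC : 0 < C) (hh : 0 < h)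
    {u w : (Fin d → ℝ) → ℝ} (hw : AEMeasurable w (volume.restrict (unitCube d)))
    (hu : ∀ᵐ x ∂volume.restrict (unitCube d), ‖u x‖ₑ ≤ ENNReal.ofReal b *
        ∫⁻ y in unitCube d, boxKernel d C h x y * ‖w y‖ₑ) :
    normL2Cube u ≤ ENNReal.ofReal b * ENNReal.ofReal ((4 * C ^ 2) ^ d) * normL2Cube w := by
  rw [normL2Cube_eq, normL2Cube_eq]
  have hmeas : ∫⁻ x in unitCube d, ‖u x‖ₑ ^ (2 : ℝ) ≤
      (ENNReal.ofReal b * ENNReal.ofReal ((4 * C ^ 2) ^ d)) ^ (2 : ℝ) *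
        ∫⁻ y in unitCube d, ‖w y‖ₑ ^ (2 : ℝ) := by
    calc ∫⁻ x in unitCube d, ‖u x‖ₑ ^ (2 : ℝ)
        ≤ ∫⁻ x in unitCube d, ENNReal.ofReal b ^ (2 : ℝ) *
            (∫⁻ y in unitCube d, boxKernel d C h x y * ‖w y‖ₑ) ^ (2 : ℝ) := by
          refine lintegral_mono_ae ?_
          filter_upwards [hu] with x hx
          rw [← ENNReal.mul_rpow_of_nonneg _ _ zero_le_two]
          exact ENNReal.rpow_le_rpow hx zero_le_two
      _ = ENNReal.ofReal b ^ (2 : ℝ) * ∫⁻ x in unitCube d,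
            (∫⁻ y in unitCube d, boxKernel d C h x y * ‖w y‖ₑ) ^ (2 : ℝ) :=
          lintegral_const_mul' _ _ (ENNReal.rpow_ne_top_of_nonneg zero_le_two ENNReal.ofReal_ne_top)
      _ ≤ ENNReal.ofReal b ^ (2 : ℝ) * (ENNReal.ofReal ((4 * C ^ 2) ^ d) ^ (2 : ℝ) *
            ∫⁻ y in unitCube d, ‖w y‖ₑ ^ (2 : ℝ)) := by
          refine mul_le_mul_right (lintegral_sq_lintegral_mul_le (measurable_boxKernel d C h)
            (fun x => lintegral_boxKernel_le hC hh x _) (fun y => ?_) hw.enorm) _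
          simp only [boxKernel_comm _ _ _ y]
          exact lintegral_boxKernel_le hC hh y _
      _ = _ := by rw [← mul_assoc, ENNReal.mul_rpow_of_nonneg _ _ zero_le_two]
  refine (ENNReal.rpow_le_rpow hmeas (by norm_num)).trans_eq ?_
  rw [ENNReal.mul_rpow_of_nonneg _ _ (by norm_num), ← ENNReal.rpow_mul]
  norm_num

theorem gridSize_bounds {d : ℕ} (hd : 0 < d) (Z : Fin d → SplineGrid 0 1) :
    0 < gridSizeMin Z ∧ ∀ j (i : Fin (Z j).N),
      gridSizeMin Z ≤ (Z j).z i.succ - (Z j).z i.castSucc ∧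
      (Z j).z i.succ - (Z j).z i.castSucc ≤ gridSize Z := by
  have hne : Nonempty (Fin d) := ⟨⟨0, hd⟩⟩
  refine ⟨?_, fun j i => ⟨?_, ?_⟩⟩
  · obtain ⟨j, hj⟩ := exists_eq_ciInf_of_finite (f := fun j => (Z j).meshMin)
    have hne' : Nonempty (Fin (Z j).N) := ⟨⟨0, (Z j).pos⟩⟩
    obtain ⟨i, hi⟩ := exists_eq_ciInf_of_finite
      (f := fun i : Fin (Z j).N => (Z j).z i.succ - (Z j).z i.castSucc)
    rw [gridSizeMin, ← hj, SplineGrid.meshMin, ← hi]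
    exact sub_pos.2 ((Z j).strictMono Fin.castSucc_lt_succ)
  · exact (ciInf_le (Finite.bddBelow_range fun j => (Z j).meshMin) j).trans
      (ciInf_le (Finite.bddBelow_range _) i)
  · exact (le_ciSup (Finite.bddAbove_range
      fun i : Fin (Z j).N => (Z j).z i.succ - (Z j).z i.castSucc) i).trans
      (le_ciSup (Finite.bddAbove_range fun j => (Z j).meshSize) j)

theorem seminormW1Inf_lt_top {d : ℕ} {Q : Set (Fin d → ℝ)} {ρ : (Fin d → ℝ) → ℝ}
    (hρ : MemW1Inf Q ρ) : seminormW1Inf Q ρ < ⊤ := by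
  refine (Finset.sup_univ_eq_iSup _).symm.trans_lt
    ((Finset.sup_lt_iff (by exact ENNReal.zero_lt_top)).2 fun i _ => ?_)
  obtain ⟨g, hg, hgM⟩ := hρ.2 i
  exact (iInf₂_le g hg).trans_lt hgM.2

/-- A function in `W^1_∞` of the cube is Lipschitz off a null set, with a constant as close to the
seminorm as desired. -/
theorem MemW1Inf.exists_lipschitz {d : ℕ} {ρ : (Fin d → ℝ) → ℝ} (hρ : MemW1Inf (unitCube d) ρ)
    {ε : ℝ} (hε : 0 < ε) :
    ∃ G ⊆ unitCube d, (∀ᵐ x ∂volume.restrict (unitCube d), x ∈ G) ∧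
      ∀ x ∈ G, ∀ y ∈ G, |ρ x - ρ y| ≤
        (d * ((seminormW1Inf (unitCube d) ρ).toReal + ε)) * ‖x - y‖ := by
  set s := seminormW1Inf (unitCube d) ρ with hs
  have hfin : s ≠ ⊤ := (seminormW1Inf_lt_top hρ).ne
  -- The seminorm is an infimum over representatives; allowing `ε` avoids proving that it is
  -- attained.
  have hex : ∀ i, ∃ g, IsWeakPartialDeriv (unitCube d) i ρ g ∧
      eLpNorm g ∞ (volume.restrict (unitCube d)) < s + ENNReal.ofReal ε := by
    intro i
    have hlt : ⨅ (g : (Fin d → ℝ) → ℝ) (_ : IsWeakPartialDeriv (unitCube d) i ρ g),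
        eLpNorm g ∞ (volume.restrict (unitCube d)) < s + ENNReal.ofReal ε :=
      (le_iSup (fun i : Fin d => ⨅ (g : (Fin d → ℝ) → ℝ)
        (_ : IsWeakPartialDeriv (unitCube d) i ρ g),
        eLpNorm g ∞ (volume.restrict (unitCube d))) i).trans_lt
        (ENNReal.lt_add_right hfin (ENNReal.ofReal_pos.2 hε).ne')
    obtain ⟨g, hg⟩ := iInf_lt_iff.1 hlt
    obtain ⟨hgw, hg⟩ := iInf_lt_iff.1 hg
    exact ⟨g, hgw, hg⟩
  choose g hgw hg using hex
  have hM : ∀ i, ∀ᵐ x ∂volume.restrict (unitCube d), |g i x| ≤ s.toReal + ε := by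
    intro i
    filter_upwards [ae_le_eLpNormEssSup (f := g i) (μ := volume.restrict (unitCube d))] with x hx
    rw [← eLpNorm_exponent_top] at hx
    have h1 := hx.trans (hg i).le
    rw [← ENNReal.ofReal_toReal hfin, ← ENNReal.ofReal_add ENNReal.toReal_nonneg hε.le,
      Real.enorm_eq_ofReal_abs] at h1
    exact (ENNReal.ofReal_le_ofReal_iff (by positivity)).1 h1
  have : IsFiniteMeasure (volume.restrict (unitCube d)) :=
    ⟨by rw [Measure.restrict_apply_univ, volume_unitCube]; exact ENNReal.one_lt_top⟩
  have hint : IntegrableOn ρ (unitCube d) := hρ.1.integrable le_top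
  obtain ⟨G, hGQ, hG, hL⟩ := exists_lipschitz_of_weakPartialDeriv hint hgw hM
  refine ⟨G, hGQ, hG, ?_⟩
  simpa only [Finset.sum_const, Finset.card_univ, Fintype.card_fin, nsmul_eq_mul] using hL

theorem theorem3p2 (d : ℕ) (hd : 0 < d) (p k : ℕ) (hk : k < p) (σ : ℝ) :
    ∃ c : ℝ, 0 < c ∧
      ∀ Z : Fin d → SplineGrid 0 1, gridSize Z / gridSizeMin Z ≤ σ →
        ∀ w ∈ tensorSplineSpace p k Z, ∀ ρ : (Fin d → ℝ) → ℝ, MemW1Inf (unitCube d) ρ →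
          ⨅ v ∈ tensorSplineSpace p k Z, normL2Cube (fun x => ρ x * w x - v x) ≤
            ENNReal.ofReal (c * gridSize Z) * seminormW1Inf (unitCube d) ρ * normL2Cube w := by
  have hσ : 1 ≤ max σ 1 := le_max_right _ _
  obtain ⟨C, hC, hker⟩ := exists_local_kernels hk hσ
  have hd' : (0 : ℝ) < d := by exact_mod_cast hd
  -- The factor $d$ comes from the Lipschitz constant, $C+1$ from the distance to the sample point,
  -- and $(4C^2)^d$ from Schur's test.
  refine ⟨d * (C + 1) * (4 * C ^ 2) ^ d, by positivity, fun Z hZ w hw ρ hρ => ?_⟩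
  obtain ⟨hmin, hspan⟩ := gridSize_bounds hd Z
  set h := gridSize Z
  have hle := fun j i => (hspan j i).2
  have hh : 0 < h := hmin.trans_le ((hspan ⟨0, hd⟩ ⟨0, (Z _).pos⟩).1.trans (hle _ _))
  have hge : ∀ j (i : Fin (Z j).N), h ≤ max σ 1 * ((Z j).z i.succ - (Z j).z i.castSucc) :=
    fun j i => ((div_le_iff₀ hmin).1 (hZ.trans (le_max_left σ 1))).trans
      (mul_le_mul_of_nonneg_left (hspan j i).1 (zero_le_one.trans hσ))
  choose n K ξ hξ hmeas hsum hloc hK using fun j => hker h (Z j) hh (hle j) (hge j)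
  have hwm : AEMeasurable w (volume.restrict (unitCube d)) :=
    (continuousOn_of_mem_tensorSplineSpace hw).aemeasurable (isOpen_unitCube d).measurableSet
  have hwfin : normL2Cube w ≠ ⊤ := by
    obtain ⟨B, hB⟩ := exists_bound_of_mem_tensorSplineSpace
      (fun j => (Z j).isKnotSequence hh hσ (hle j) (hge j)) hw
    have : IsFiniteMeasure (volume.restrict (unitCube d)) :=
      ⟨by rw [Measure.restrict_apply_univ, volume_unitCube]; exact ENNReal.one_lt_top⟩
    refine (MemLp.of_bound hwm.aestronglyMeasurable B ?_).2.ne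
    filter_upwards [ae_restrict_mem (isOpen_unitCube d).measurableSet] with x hx
    exact hB x hx
  set s := seminormW1Inf (unitCube d) ρ with hs
  have hfin : s ≠ ⊤ := (seminormW1Inf_lt_top hρ).ne
  have hbound : ∀ ε : ℝ, 0 < ε →
      ⨅ v ∈ tensorSplineSpace p k Z, normL2Cube (fun x => ρ x * w x - v x) ≤
        ENNReal.ofReal (d * (C + 1) * (4 * C ^ 2) ^ d * h) * ENNReal.ofReal (s.toReal + ε) *
          normL2Cube w := by
    intro ε hε
    obtain ⟨G, hGQ, hG, hL⟩ := hρ.exists_lipschitz hε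
    obtain ⟨v, hv, hvx⟩ := exists_enorm_mul_sub_le hC hh
      (L := d * (s.toReal + ε)) (by positivity) hξ hsum hloc hmeas hK hw hGQ hG hL
    refine (iInf₂_le v hv).trans ((normL2Cube_le_of_ae_le hC hh hwm
      (hG.mono hvx)).trans_eq ?_)
    rw [← ENNReal.ofReal_mul (by positivity), ← ENNReal.ofReal_mul (by positivity)]
    congr 2
    ring
  -- Letting `ε` tend to zero needs $\|w\|$ finite, since the seminorm may be zero.
  have hlim : Filter.Tendsto (fun ε : ℝ =>
      ENNReal.ofReal (d * (C + 1) * (4 * C ^ 2) ^ d * h) * ENNReal.ofReal (s.toReal + ε) *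
        normL2Cube w) (nhdsWithin 0 (Ioi 0))
      (nhds (ENNReal.ofReal (d * (C + 1) * (4 * C ^ 2) ^ d * h) * s * normL2Cube w)) := by
    refine ENNReal.Tendsto.mul_const (ENNReal.Tendsto.const_mul ?_ (Or.inr ENNReal.ofReal_ne_top))
      (Or.inr hwfin)
    have h1 : Filter.Tendsto (fun ε : ℝ => ENNReal.ofReal (s.toReal + ε)) (nhds 0)
        (nhds (ENNReal.ofReal (s.toReal + 0))) :=
      (ENNReal.continuous_ofReal.comp (continuous_const.add continuous_id)).tendsto 0
    rw [add_zero, ENNReal.ofReal_toReal hfin] at h1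
    exact h1.mono_left nhdsWithin_le_nhds
  exact ge_of_tendsto hlim (Filter.eventually_of_mem self_mem_nhdsWithin fun ε hε => hbound ε hε)
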